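/- An L-shape with parameters $\ell_x,\ell_y,w_x,w_y$, where $0<w_x\le \ell_x\le 1$ and $0<w_y\le \ell_y\le 1$, is the union of an axis-parallel rectangle of width $\ell_x$ and height $w_y$ and an axis-parallel rectangle of width $w_x$ and height $\ell_y$ whose lower left corners coincide; $\ell_x,\ell_y$ are its arm lengths. Sequences of L-shapes are packed by translation, so that the interiors of distinct L-shapes are disjoint. A (deterministic) online algorithm places each L-shape irrevocably, knowing only that L-shape and the earlier ones. In strip packing the container is $[0,\infty)\times[0,1]$ and the cost is the maximum $x$-coordinate of an occupied point; in perimeter packing and in area packing the container is the plane and the cost is the perimeter, respectively the area, of the axis-parallel bounding box of the packing. For a finite sequence $I$ of $|I|$ L-shapes let $\mathrm{OPT}(I)$ be the optimal (infimum) offline cost and $\mathcal A(I)$ the cost of algorithm $\mathcal A$. For $f:\mathbb N\to\mathbb R$, $\mathcal A$ has (absolute) competitive ratio $f(n)$ if $\mathcal A(I)\le f(|I|)\cdot\mathrm{OPT}(I)$ for all $I$, and asymptotic competitive ratio $f(n)$ if there is a constant $\beta>0$ with $\mathcal A(I)\le f(|I|)\cdot \mathrm{OPT}(I)+\beta$ for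 all $I$. The online critical packing density for arm lengths bounded by $t$ is the supremum of all $A\ge 0$ such that some online algorithm packs every sequence of L-shapes with arm lengths at most $t$ and total area at most $A$ into the unit square $[0,1]^2$. Then: (i) The asymptotic competitive ratio of any online algorithm for strip packing of L-shapes is in $\Omega(n/\log n)$: there is a constant $c>0$ such that, whenever an online algorithm has asymptotic competitive ratio $f(n)$, one has $f(n)\ge c\,n/\log n$ for all sufficiently large $n$. (ii) There is an online algorithm for perimeter packing of L-shapes with absolute competitive ratio in $O(1)$. (iii) There is an online algorithm for area packing of L-shapes with asymptotic competitive ratio in $O(\sqrt n)$. (iv) For every $t<1$ the online critical packing density for arm lengths bounded by $t$ is positive, and for $t=1$ it is $0$. -/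

import Mathlib

open scoped NNReal ENNReal

/-- An L-shape with arm lengths at most `1`, up to translation: the union of an `lx × wy`
rectangle and a `wx × ly` rectangle with common lower left corner.  Arms have positive
thickness; rectangles (`wx = lx` or `wy = ly`) are allowed. -/
structure LShape where
  lx : ℝ
  ly : ℝ
  wx : ℝ
  wy : ℝ
  wx_pos : 0 < wx
  wy_pos : 0 < wy
  wx_le : wx ≤ lx
  wy_le : wy ≤ ly
  lx_le_one : lx ≤ 1
  ly_le_one : ly ≤ 1

namespace LShape

/-- The closed region covered by `L` when its lower left corner is placed at `p`. -/
def region (L : LShape) (p : ℝ × ℝ) : Set (ℝ × ℝ) :=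
  Set.Icc p.1 (p.1 + L.lx) ×ˢ Set.Icc p.2 (p.2 + L.wy) ∪
    Set.Icc p.1 (p.1 + L.wx) ×ˢ Set.Icc p.2 (p.2 + L.ly)

/-- The area of an L-shape. -/
def area (L : LShape) : ℝ := L.lx * L.wy + L.wx * L.ly - L.wx * L.wy

end LShape

namespace LPacking

/-- `P` is a packing by translation of the sequence `σ` into the container `C`, the `i`-th
object having its lower left corner at `P i`: every object lies in `C`, and distinct objects
have disjoint interiors (they may touch). -/
def IsPacking (C : Set (ℝ × ℝ)) (σ : List LShape) (P : Fin σ.length → ℝ × ℝ) : Prop :=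
  (∀ i, (σ.get i).region (P i) ⊆ C) ∧
    Pairwise fun i j =>
      Disjoint (interior ((σ.get i).region (P i))) (interior ((σ.get j).region (P j)))

/-- The set of points occupied by the sequence `σ` placed at `P`. -/
def occupied (σ : List LShape) (P : Fin σ.length → ℝ × ℝ) : Set (ℝ × ℝ) :=
  ⋃ i, (σ.get i).region (P i)

/-- A deterministic online algorithm: given the sequence of objects presented so far, it
returns the position of the last one.  Thus the position of an object depends only on that
object and the earlier ones, and is never revised. -/
abbrev OnlineAlgorithm := List LShape → ℝ × ℝ

/-- The positions that the online algorithm assigns to the objects of the sequence `σ`. -/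
def OnlineAlgorithm.run (𝒜 : OnlineAlgorithm) (σ : List LShape) : Fin σ.length → ℝ × ℝ :=
  fun i => 𝒜 (σ.take (i + 1))

/-- A packing variant: the container, and the cost of a packing as a function of the set of
occupied points, to be minimized. -/
structure Variant where
  container : Set (ℝ × ℝ)
  cost : Set (ℝ × ℝ) → ℝ

/-- The width of the bounding box of `S` (zero for the empty set). -/
noncomputable def bbWidth (S : Set (ℝ × ℝ)) : ℝ := sSup (Prod.fst '' S) - sInf (Prod.fst '' S)

/-- The height of the bounding box of `S` (zero for the empty set). -/
noncomputable def bbHeight (S : Set (ℝ × ℝ)) : ℝ := sSup (Prod.snd '' S) - sInf (Prod.snd '' S)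

/-- Strip packing: the container is the horizontal strip `[0, ∞) × [0, 1]`, the cost is the
maximum `x`-coordinate of an occupied point. -/
noncomputable def stripPack : Variant where
  container := Set.Ici 0 ×ˢ Set.Icc 0 1
  cost S := sSup (Prod.fst '' S)

/-- Perimeter packing: place in the plane, minimizing the perimeter of the bounding box. -/
noncomputable def periPack : Variant where
  container := Set.univ
  cost S := 2 * (bbWidth S + bbHeight S)

/-- Area packing: place in the plane, minimizing the area of the bounding box. -/
noncomputable def areaPack : Variant where
  container := Set.univ
  cost S := bbWidth S * bbHeight S

namespace Variant

/-- The offline optimum for the sequence `σ`. -/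
noncomputable def opt (V : Variant) (σ : List LShape) : ℝ :=
  sInf {c | ∃ P, IsPacking V.container σ P ∧ c = V.cost (occupied σ P)}

/-- `𝒜` is an online algorithm for the variant `V`: it packs every sequence. -/
def Solves (V : Variant) (𝒜 : OnlineAlgorithm) : Prop :=
  ∀ σ, IsPacking V.container σ (𝒜.run σ)

/-- The cost of the packing that `𝒜` computes for the sequence `σ`. -/
noncomputable def algCost (V : Variant) (𝒜 : OnlineAlgorithm) (σ : List LShape) : ℝ :=
  V.cost (occupied σ (𝒜.run σ))

/-- `𝒜` has (absolute) competitive ratio `f(n)`, with `n` the number of objects. -/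
def HasCompetitiveRatio (V : Variant) (𝒜 : OnlineAlgorithm) (f : ℕ → ℝ) : Prop :=
  ∀ σ, V.algCost 𝒜 σ ≤ f σ.length * V.opt σ

/-- `𝒜` has asymptotic competitive ratio `f(n)`, with `n` the number of objects. -/
def HasAsymptoticCompetitiveRatio (V : Variant) (𝒜 : OnlineAlgorithm) (f : ℕ → ℝ) : Prop :=
  ∃ β : ℝ, 0 < β ∧ ∀ σ, V.algCost 𝒜 σ ≤ f σ.length * V.opt σ + β

end Variant

/-- `𝒜` packs into the unit square every sequence of L-shapes with arm lengths at most `t`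
and total area at most `A`. -/
def PacksUnitSquare (𝒜 : OnlineAlgorithm) (t A : ℝ) : Prop :=
  ∀ σ : List LShape, (∀ L ∈ σ, L.lx ≤ t ∧ L.ly ≤ t) → (σ.map LShape.area).sum ≤ A →
    IsPacking (Set.Icc 0 1 ×ˢ Set.Icc 0 1) σ (𝒜.run σ)

/-- The online critical packing density of the unit square for L-shapes with arm lengths at
most `t`: the supremum of the `A` such that some online algorithm packs every sequence of
total area at most `A`.  (If `t ≤ 0` there are no such L-shapes and the value is `∞`.) -/
noncomputable def onlineCriticalDensity (t : ℝ) : ℝ≥0∞ :=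
  ⨆ A ∈ {A : ℝ≥0 | ∃ 𝒜 : OnlineAlgorithm, PacksUnitSquare 𝒜 t A}, (A : ℝ≥0∞)

end LPacking

/-! **Online algorithms (ii)–(iv).**  L-shapes of the same class, that is with equal dyadic size
classes of both arms, nest along a diagonal: successive shapes share a box as long as the sum of
their relative thicknesses is at most `1`.  The boxes of a height class are put on shelves, and
the shelves are stacked.  As full boxes contain a proportional area and the sizes of the others
are dyadically summable, sequences of area `ηXY` with arms at most `X` and `Y` fit in a rectangle
of size `(1 + 2η)X × O(Y / η)`, online.  Perimeter and area packing restart this in a fresh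
square, twice as large, whenever the area or an arm outgrows the current one.  In the unit square,
shapes with a very short vertical arm go to a shelf packing along the bottom, the others with a
very short horizontal arm to one along the left, and the few remaining shapes form a diagonal
staircase.

**Lower bound (i).**  All shapes have unit feet, of thickness `2 ^ (-k - 1)` for different keys
`k`, and spines of length `1 - 2 ^ (-k - 1)`.  If two of them start in a common window of width
`1`, the larger key has to be on the left, at distance at least the spine thickness `1 / (n + 1)`.
The adversary bisects: it presents a median key among those still available, and retains the half
that gets squeezed into the smaller part of the window.  Hence every unit of the strip receives
only `O(log n)` of the `n` shapes, while the sorted order needs width `2` offline. -/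

namespace LShape

theorem lx_pos (L : LShape) : 0 < L.lx := L.wx_pos.trans_le L.wx_le

theorem ly_pos (L : LShape) : 0 < L.ly := L.wy_pos.trans_le L.wy_le

theorem wx_mul_ly_le_area (L : LShape) : L.wx * L.ly ≤ L.area := by
  have h := mul_le_mul_of_nonneg_right L.wx_le L.wy_pos.le
  unfold area; linarith

theorem lx_mul_wy_le_area (L : LShape) : L.lx * L.wy ≤ L.area := by
  have h := mul_le_mul_of_nonneg_left L.wy_le L.wx_pos.le
  unfold area; linarith

theorem area_pos (L : LShape) : 0 < L.area :=
  (mul_pos L.wx_pos L.ly_pos).trans_le L.wx_mul_ly_le_area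

/-- The reflection of an L-shape in the diagonal. -/
def transpose (L : LShape) : LShape :=
  ⟨L.ly, L.lx, L.wy, L.wx, L.wy_pos, L.wx_pos, L.wy_le, L.wx_le, L.ly_le_one, L.lx_le_one⟩

theorem area_transpose (L : LShape) : L.transpose.area = L.area := by
  unfold area transpose; ring

theorem region_subset_quadrant (L : LShape) (p : ℝ × ℝ) :
    L.region p ⊆ Set.Ici p.1 ×ˢ Set.Ici p.2 := by
  rintro ⟨x, y⟩ (h | h) <;> exact ⟨h.1.1, h.2.1⟩

theorem region_subset_box (L : LShape) (p : ℝ × ℝ) :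
    L.region p ⊆ Set.Icc p.1 (p.1 + L.lx) ×ˢ Set.Icc p.2 (p.2 + L.ly) := by
  rintro ⟨x, y⟩ (h | h)
  · exact ⟨h.1, h.2.1, h.2.2.trans (by have := L.wy_le; linarith)⟩
  · exact ⟨⟨h.1.1, h.1.2.trans (by have := L.wx_le; linarith)⟩, h.2⟩

theorem corner_mem_region (L : LShape) (p : ℝ × ℝ) : p ∈ L.region p := by
  have := L.lx_pos; have := L.wy_pos
  exact Or.inl ⟨⟨le_rfl, by linarith⟩, ⟨le_rfl, by linarith⟩⟩

theorem right_mem_region (L : LShape) (p : ℝ × ℝ) : (p.1 + L.lx, p.2) ∈ L.region p := by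
  have := L.lx_pos; have := L.wy_pos
  exact Or.inl ⟨⟨by simp only; linarith, le_rfl⟩, ⟨le_rfl, by simp only; linarith⟩⟩

theorem top_mem_region (L : LShape) (p : ℝ × ℝ) : (p.1, p.2 + L.ly) ∈ L.region p := by
  have := L.ly_pos; have := L.wx_pos
  exact Or.inr ⟨⟨le_rfl, by simp only; linarith⟩, ⟨by simp only; linarith, le_rfl⟩⟩

theorem foot_subset_interior (L : LShape) (p : ℝ × ℝ) :
    Set.Ioo p.1 (p.1 + L.lx) ×ˢ Set.Ioo p.2 (p.2 + L.wy) ⊆ interior (L.region p) :=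
  interior_maximal (fun _ h => Or.inl ⟨Set.Ioo_subset_Icc_self h.1, Set.Ioo_subset_Icc_self h.2⟩)
    (isOpen_Ioo.prod isOpen_Ioo)

theorem spine_subset_interior (L : LShape) (p : ℝ × ℝ) :
    Set.Ioo p.1 (p.1 + L.wx) ×ˢ Set.Ioo p.2 (p.2 + L.ly) ⊆ interior (L.region p) :=
  interior_maximal (fun _ h => Or.inr ⟨Set.Ioo_subset_Icc_self h.1, Set.Ioo_subset_Icc_self h.2⟩)
    (isOpen_Ioo.prod isOpen_Ioo)

theorem isCompact_region (L : LShape) (p : ℝ × ℝ) : IsCompact (L.region p) :=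
  (isCompact_Icc.prod isCompact_Icc).union (isCompact_Icc.prod isCompact_Icc)

open MeasureTheory in
theorem area_le_volume (L : LShape) (p : ℝ × ℝ) :
    ENNReal.ofReal L.area ≤ volume (interior (L.region p)) := by
  have hsub : Set.Ioo p.1 (p.1 + L.lx) ×ˢ Set.Ioo p.2 (p.2 + L.wy) ∪
      Set.Ioo p.1 (p.1 + L.wx) ×ˢ Set.Ioo (p.2 + L.wy) (p.2 + L.ly) ⊆ interior (L.region p) :=
    Set.union_subset (L.foot_subset_interior p) <|
      (Set.prod_mono_right (Set.Ioo_subset_Ioo_left (by linarith [L.wy_pos]))).trans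
        (L.spine_subset_interior p)
  have hdisj : Disjoint (Set.Ioo p.1 (p.1 + L.lx) ×ˢ Set.Ioo p.2 (p.2 + L.wy))
      (Set.Ioo p.1 (p.1 + L.wx) ×ˢ Set.Ioo (p.2 + L.wy) (p.2 + L.ly)) :=
    Set.disjoint_left.2 fun _ h h' => (h.2.2.trans h'.2.1).false
  have hfoot := mul_pos L.lx_pos L.wy_pos
  have hspine := mul_nonneg L.wx_pos.le (sub_nonneg.2 L.wy_le)
  calc ENNReal.ofReal L.area
      = ENNReal.ofReal (L.lx * L.wy + L.wx * (L.ly - L.wy)) := by congr 1; unfold area; ring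
    _ = volume (Set.Ioo p.1 (p.1 + L.lx) ×ˢ Set.Ioo p.2 (p.2 + L.wy) ∪
          Set.Ioo p.1 (p.1 + L.wx) ×ˢ Set.Ioo (p.2 + L.wy) (p.2 + L.ly)) := by
      rw [measure_union hdisj (measurableSet_Ioo.prod measurableSet_Ioo), Measure.volume_eq_prod,
        Measure.prod_prod, Measure.prod_prod, Real.volume_Ioo, Real.volume_Ioo, Real.volume_Ioo,
        Real.volume_Ioo, ← ENNReal.ofReal_mul (by linarith [L.lx_pos]),
        ← ENNReal.ofReal_mul (by linarith [L.wx_pos]), add_sub_cancel_left, add_sub_cancel_left,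
        add_sub_cancel_left, add_sub_add_left_eq_sub, ENNReal.ofReal_add hfoot.le hspine]
    _ ≤ _ := measure_mono hsub

end LShape

namespace LPacking

section Lists

variable {α β : Type*} {σ τ : List α} {a : α}

/-- The outputs of the online rule `f` on the successive elements of a list, where `f τ a` is the
output on `a` after the elements of `τ`. -/
def trace (f : List α → α → β) (σ : List α) : List β :=
  σ.reverseRecOn [] fun τ a bs => bs ++ [f τ a]

theorem trace_nil (f : List α → α → β) : trace f [] = [] := by
  rw [trace, List.reverseRecOn_nil]

theorem trace_concat (f : List α → α → β) (τ : List α) (a : α) :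
    trace f (τ ++ [a]) = trace f τ ++ [f τ a] := by
  simp only [trace, List.reverseRecOn_concat]

theorem trace_isPrefix (f : List α → α → β) {τ σ : List α} (h : τ <+: σ) :
    trace f τ <+: trace f σ := by
  obtain ⟨ρ, rfl⟩ := h
  induction ρ using List.reverseRecOn with
  | nil => simp
  | append_singleton ρ a ih =>
    rw [← List.append_assoc, trace_concat]
    exact ih.trans (List.prefix_append _ _)

theorem length_trace (f : List α → α → β) (σ : List α) :
    (trace f σ).length = σ.length := by
  induction σ using List.reverseRecOn with
  | nil => rw [trace_nil, List.length_nil, List.length_nil]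
  | append_singleton σ a ih =>
    rw [trace_concat, List.length_append, List.length_append, ih, List.length_singleton,
      List.length_singleton]

theorem mem_trace {f : List α → α → β} {σ : List α} {b : β} :
    b ∈ trace f σ ↔ ∃ τ a, τ ++ [a] <+: σ ∧ f τ a = b := by
  induction σ using List.reverseRecOn with
  | nil => simp [trace_nil]
  | append_singleton σ a ih =>
    rw [trace_concat, List.mem_append, ih, List.mem_singleton]
    constructor
    · rintro (⟨τ, c, h, rfl⟩ | rfl)
      · exact ⟨τ, c, h.trans (List.prefix_append _ _), rfl⟩
      · exact ⟨σ, a, List.prefix_rfl, rfl⟩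
    · rintro ⟨τ, c, h, rfl⟩
      rcases List.prefix_concat_iff.1 h with h | h
      · obtain ⟨rfl, hc⟩ := List.append_inj' h rfl
        obtain rfl := List.singleton_inj.1 hc
        exact .inr rfl
      · exact .inl ⟨τ, c, h, rfl⟩

theorem filter_concat_isPrefix {p : α → Bool}
    (h : τ ++ [a] <+: σ) (ha : p a) : τ.filter p ++ [a] <+: σ.filter p := by
  simpa only [List.filter_append, List.filter_singleton, ha, cond_true] using h.filter p

theorem map_concat_isPrefix (f : α → β)
    (h : τ ++ [a] <+: σ) : τ.map f ++ [f a] <+: σ.map f := by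
  simpa only [List.map_append, List.map_singleton] using h.map f

theorem forall_mem_of_concat_isPrefix {p : α → Prop}
    (h : ∀ b ∈ σ, p b) (hτ : τ ++ [a] <+: σ) : p a :=
  h a (hτ.subset (by simp))

theorem sum_add_le_of_concat_isPrefix {w : α → ℝ}
    (hw : ∀ b, 0 ≤ w b) (h : τ ++ [a] <+: σ) : (τ.map w).sum + w a ≤ (σ.map w).sum := by
  simpa using (h.sublist.map w).sum_le_sum (by simpa using fun b _ => hw b)

theorem take_concat_get_isPrefix (σ : List α) (i : Fin σ.length) :
    σ.take i ++ [σ.get i] <+: σ := by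
  rw [List.get_eq_getElem, List.take_append_getElem]
  exact List.take_prefix _ _

end Lists

/-- The online algorithm that places the object `L`, arriving after the objects of `τ`, at
`f τ L`. -/
def ofRule (f : List LShape → LShape → ℝ × ℝ) : OnlineAlgorithm := fun σ =>
  σ.reverseRecOn 0 fun τ L _ => f τ L

theorem ofRule_concat (f : List LShape → LShape → ℝ × ℝ) (τ : List LShape) (L : LShape) :
    ofRule f (τ ++ [L]) = f τ L := by
  simp only [ofRule, List.reverseRecOn_concat]

theorem run_ofRule (f : List LShape → LShape → ℝ × ℝ) (σ : List LShape) (i : Fin σ.length) :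
    (ofRule f).run σ i = f (σ.take i) (σ.get i) := by
  rw [← ofRule_concat f, List.get_eq_getElem, List.take_append_getElem, OnlineAlgorithm.run]

/-- The shape `L` at `p` lies left of or below the quadrant with lower left corner `q`, or that
quadrant fits into its inner corner. -/
def Precedes (L : LShape) (p q : ℝ × ℝ) : Prop :=
  p.1 + L.lx ≤ q.1 ∨ p.2 + L.ly ≤ q.2 ∨ (p.1 + L.wx ≤ q.1 ∧ p.2 + L.wy ≤ q.2)

theorem Precedes.disjoint_interior {L : LShape} {p q : ℝ × ℝ} (h : Precedes L p q) (K : LShape) :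
    Disjoint (interior (L.region p)) (interior (K.region q)) := by
  have hK : interior (K.region q) ⊆ Set.Ioi q.1 ×ˢ Set.Ioi q.2 := by
    refine (interior_mono (K.region_subset_quadrant q)).trans ?_
    rw [interior_prod_eq, interior_Ici, interior_Ici]
  rw [Set.disjoint_left]
  rintro ⟨x, y⟩ hxy hxy'
  obtain ⟨hx : q.1 < x, hy : q.2 < y⟩ := hK hxy'
  replace hxy := interior_subset hxy
  obtain ⟨⟨-, hxL : x ≤ p.1 + L.lx⟩, -, hyL : y ≤ p.2 + L.ly⟩ := L.region_subset_box p hxy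
  rcases h with h | h | ⟨h, h'⟩
  · linarith
  · linarith
  · obtain ⟨-, -, hy' : y ≤ p.2 + L.wy⟩ | ⟨⟨-, hx' : x ≤ p.1 + L.wx⟩, -⟩ := hxy <;> linarith

/-- A sufficient condition for disjoint interiors: one of the two placed shapes precedes the
other. -/
def Separated (L : LShape) (p : ℝ × ℝ) (K : LShape) (q : ℝ × ℝ) : Prop :=
  Precedes L p q ∨ Precedes K q p

namespace Separated

variable {L K : LShape} {p q : ℝ × ℝ}

theorem symm (h : Separated L p K q) : Separated K q L p := Or.symm h

theorem disjoint_interior (h : Separated L p K q) :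
    Disjoint (interior (L.region p)) (interior (K.region q)) :=
  h.elim (·.disjoint_interior K) fun h => (h.disjoint_interior L).symm

theorem translate (h : Separated L p K q) (v : ℝ × ℝ) : Separated L (v + p) K (v + q) := by
  simpa only [Separated, Precedes, Prod.fst_add, Prod.snd_add, add_assoc, add_le_add_iff_left]
    using h

theorem transpose (h : Separated L.transpose p K.transpose q) :
    Separated L p.swap K q.swap := by
  simp only [Separated, Precedes, LShape.transpose, Prod.fst_swap, Prod.snd_swap] at h ⊢
  tauto

end Separated

/-- The shape `L` at `p` lies in the rectangle `[x₀, x₁] × [y₀, y₁]`. -/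
structure InRect (L : LShape) (p : ℝ × ℝ) (x₀ x₁ y₀ y₁ : ℝ) : Prop where
  left : x₀ ≤ p.1
  right : p.1 + L.lx ≤ x₁
  bottom : y₀ ≤ p.2
  top : p.2 + L.ly ≤ y₁

namespace InRect

variable {L K : LShape} {p q : ℝ × ℝ} {x₀ x₁ y₀ y₁ x₂ x₃ y₂ y₃ : ℝ}

theorem region_subset (h : InRect L p x₀ x₁ y₀ y₁) :
    L.region p ⊆ Set.Icc x₀ x₁ ×ˢ Set.Icc y₀ y₁ :=
  (L.region_subset_box p).trans <|
    Set.prod_mono (Set.Icc_subset_Icc h.left h.right) (Set.Icc_subset_Icc h.bottom h.top)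

theorem mono (h : InRect L p x₀ x₁ y₀ y₁) (hx₀ : x₂ ≤ x₀) (hx₁ : x₁ ≤ x₃) (hy₀ : y₂ ≤ y₀)
    (hy₁ : y₁ ≤ y₃) : InRect L p x₂ x₃ y₂ y₃ :=
  ⟨hx₀.trans h.left, h.right.trans hx₁, hy₀.trans h.bottom, h.top.trans hy₁⟩

theorem translate (h : InRect L p x₀ x₁ y₀ y₁) (v : ℝ × ℝ) :
    InRect L (v + p) (v.1 + x₀) (v.1 + x₁) (v.2 + y₀) (v.2 + y₁) := by
  obtain ⟨hx₀, hx₁, hy₀, hy₁⟩ := h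
  constructor <;> simp only [Prod.fst_add, Prod.snd_add] <;> linarith

theorem transpose (h : InRect L.transpose p x₀ x₁ y₀ y₁) : InRect L p.swap y₀ y₁ x₀ x₁ :=
  ⟨h.bottom, h.top, h.left, h.right⟩

theorem separated_of_left (h : InRect L p x₀ x₁ y₀ y₁) (h' : InRect K q x₁ x₃ y₂ y₃) :
    Separated L p K q := .inl (.inl (h.right.trans h'.left))

theorem separated_of_below (h : InRect L p x₀ x₁ y₀ y₁) (h' : InRect K q x₂ x₃ y₁ y₃) :
    Separated L p K q := .inl (.inr (.inl (h.top.trans h'.bottom)))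

end InRect

section Packings

variable {σ : List LShape} {P : Fin σ.length → ℝ × ℝ} {C : Set (ℝ × ℝ)}

theorem isPacking_of_separated (hC : ∀ i, (σ.get i).region (P i) ⊆ C)
    (hsep : ∀ i j, i < j → Separated (σ.get i) (P i) (σ.get j) (P j)) : IsPacking C σ P :=
  ⟨hC, fun i j hij => (lt_or_gt_of_ne hij).elim (fun h => (hsep i j h).disjoint_interior)
    fun h => (hsep j i h).disjoint_interior.symm⟩

theorem isPacking_ofRule {f : List LShape → LShape → ℝ × ℝ}
    (hC : ∀ τ L, τ ++ [L] <+: σ → L.region (f τ L) ⊆ C)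
    (hsep : ∀ τ L ρ K, τ ++ [L] <+: ρ → ρ ++ [K] <+: σ → Separated L (f τ L) K (f ρ K)) :
    IsPacking C σ ((ofRule f).run σ) := by
  refine isPacking_of_separated (fun i => ?_) fun i j hij => ?_
  · rw [run_ofRule]
    exact hC _ _ (take_concat_get_isPrefix σ i)
  · rw [run_ofRule, run_ofRule]
    refine hsep _ _ _ _ ?_ (take_concat_get_isPrefix σ j)
    rw [List.get_eq_getElem, List.take_append_getElem]
    exact List.take_prefix_take_left hij

theorem isPacking_map {ι : Type*} {ks : List ι} (hks : ks.Nodup) {f : ι → LShape}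
    {pos : ι → ℝ × ℝ} (hC : ∀ k ∈ ks, (f k).region (pos k) ⊆ C)
    (hsep : ∀ k ∈ ks, ∀ l ∈ ks, k ≠ l → Separated (f k) (pos k) (f l) (pos l)) :
    IsPacking C (ks.map f) fun i => pos (ks.get (i.cast (List.length_map f))) := by
  refine isPacking_of_separated (fun i => ?_) fun i j hij => ?_
  · simpa using hC _ (List.get_mem ks (i.cast (List.length_map f)))
  · simpa using hsep _ (List.get_mem ks (i.cast (List.length_map f))) _
      (List.get_mem ks (j.cast (List.length_map f)))
      (hks.injective_get.ne (by simpa using hij.ne))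

end Packings

/-- The total area of a sequence of L-shapes. -/
noncomputable def totalArea (σ : List LShape) : ℝ := (σ.map LShape.area).sum

theorem totalArea_nonneg (σ : List LShape) : 0 ≤ totalArea σ :=
  List.sum_nonneg (by simpa using fun L _ => L.area_pos.le)

theorem totalArea_le_of_sublist {τ σ : List LShape} (h : τ.Sublist σ) :
    totalArea τ ≤ totalArea σ :=
  (h.map _).sum_le_sum (by simpa using fun L _ => L.area_pos.le)

section Bins

variable {B K : Type*} [DecidableEq B] [DecidableEq K]

/-- The first occurrence of `b` in `bs` comes before that of `c`, if any. -/
abbrev Before (bs : List B) (b c : B) : Prop := bs.idxOf b < bs.idxOf c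

theorem before_trichotomy {bs : List B} {b c : B} (hb : b ∈ bs) :
    Before bs b c ∨ b = c ∨ Before bs c b :=
  (lt_trichotomy _ _).imp_right (.imp_left (List.idxOf_inj hb).1)

/-- The left end of the bin `b` when the bins `bs`, of sizes `g`, are laid out side by side in the
order of their first occurrences, separately for each value of the key `κ`. -/
noncomputable def offset (g : B → ℝ) (κ : B → K) (bs : List B) (b : B) : ℝ :=
  ∑ c ∈ bs.toFinset with κ c = κ b ∧ Before bs c b, g c

variable {g : B → ℝ} {κ : B → K} {bs cs : List B} {b c : B}

theorem offset_nonneg (hg : ∀ b, 0 ≤ g b) : 0 ≤ offset g κ bs b :=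
  Finset.sum_nonneg fun c _ => hg c

theorem offset_eq_of_isPrefix (h : bs <+: cs) (hb : b ∈ bs) :
    offset g κ bs b = offset g κ cs b := by
  obtain ⟨ds, rfl⟩ := h
  refine Finset.sum_congr (Finset.ext fun c => ?_) fun _ _ => rfl
  simp only [Before, Finset.mem_filter, List.mem_toFinset, List.mem_append,
    List.idxOf_append_of_mem hb]
  by_cases hc : c ∈ bs
  · simp only [hc, true_or, List.idxOf_append_of_mem hc]
  · have := List.idxOf_lt_length_of_mem hb
    simp only [hc, false_and, false_iff, List.idxOf_append_of_notMem hc]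
    omega

theorem offset_add (hb : b ∈ bs) : offset g κ bs b + g b =
    ∑ d ∈ bs.toFinset with κ d = κ b ∧ bs.idxOf d ≤ bs.idxOf b, g d := by
  rw [offset, add_comm, ← Finset.sum_insert (by simp)]
  refine Finset.sum_congr (Finset.ext fun d => ?_) fun _ _ => rfl
  simp only [Finset.mem_insert, Finset.mem_filter, List.mem_toFinset]
  constructor
  · rintro (rfl | ⟨hd, h, hlt⟩)
    exacts [⟨hb, rfl, le_rfl⟩, ⟨hd, h, hlt.le⟩]
  · rintro ⟨hd, h, hle⟩
    exact hle.eq_or_lt.imp (List.idxOf_inj hd).1 fun hlt => ⟨hd, h, hlt⟩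

theorem offset_add_le (hg : ∀ b, 0 ≤ g b) (hb : b ∈ bs) (hκ : κ b = κ c)
    (h : Before bs b c) : offset g κ bs b + g b ≤ offset g κ bs c := by
  rw [offset_add hb]
  refine Finset.sum_le_sum_of_subset_of_nonneg (fun d hd => ?_) fun d _ _ => hg d
  simp only [Finset.mem_filter] at hd ⊢
  exact ⟨hd.1, hd.2.1.trans hκ, hd.2.2.trans_lt h⟩

theorem offset_le_sum (hg : ∀ b, 0 ≤ g b) :
    offset g κ bs b ≤ ∑ c ∈ bs.toFinset with κ c = κ b, g c :=
  Finset.sum_le_sum_of_subset_of_nonneg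
    (Finset.monotone_filter_right _ fun _ _ h => h.1) fun c _ _ => hg c

theorem offset_add_le_sum (hg : ∀ b, 0 ≤ g b) (hb : b ∈ bs) :
    offset g κ bs b + g b ≤ ∑ c ∈ bs.toFinset, g c := by
  rw [offset_add hb]
  exact Finset.sum_le_sum_of_subset_of_nonneg (Finset.filter_subset _ _) fun c _ _ => hg c

end Bins

section Keys

variable {B K : Type*}

theorem card_le_of_snd_mem_Icc {S : Finset (K × ℤ)} {k : K} {t : ℝ} (ht : 0 ≤ t)
    (hS : ∀ s ∈ S, s.1 = k ∧ 0 ≤ s.2 ∧ (s.2 : ℝ) ≤ t) : (S.card : ℝ) ≤ t + 1 := by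
  have hcard : S.card ≤ (Finset.Icc 0 ⌊t⌋).card := by
    refine Finset.card_le_card_of_injOn Prod.snd (fun s hs => ?_) fun s hs s' hs' h => ?_
    · obtain ⟨-, h0, h1⟩ := hS s hs
      exact Finset.mem_coe.2 (Finset.mem_Icc.2 ⟨h0, Int.le_floor.2 h1⟩)
    · exact Prod.ext ((hS s hs).1.trans (hS s' hs').1.symm) h
  rw [Int.card_Icc, sub_zero] at hcard
  have hfloor : ((⌊t⌋ + 1).toNat : ℝ) = ⌊t⌋ + 1 := by
    exact_mod_cast Int.toNat_of_nonneg (by have := Int.floor_nonneg.2 ht; omega)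
  calc (S.card : ℝ) ≤ ((⌊t⌋ + 1).toNat : ℝ) := by exact_mod_cast hcard
    _ ≤ t + 1 := by rw [hfloor]; linarith [Int.floor_le t]

variable [DecidableEq K] {κ : B → K}

theorem sum_mul_sum_filter_le {I : Finset K} {M : Multiset B} {g : K → ℝ} {v : B → ℝ}
    (hg : ∀ k, 0 ≤ g k) (hv : ∀ b, 0 ≤ v b) :
    ∑ k ∈ I, g k * ((M.filter (κ · = k)).map v).sum ≤ (M.map fun b => g (κ b) * v b).sum := by
  induction M using Multiset.induction with
  | empty => simp
  | cons b M ih =>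
    have hb : ∑ k ∈ I, (if κ b = k then g k * v b else 0) ≤ g (κ b) * v b := by
      rw [Finset.sum_ite_eq]
      split_ifs
      exacts [le_rfl, mul_nonneg (hg _) (hv _)]
    have hk : ∀ k, g k * (((b ::ₘ M).filter (κ · = k)).map v).sum =
        (if κ b = k then g k * v b else 0) + g k * ((M.filter (κ · = k)).map v).sum := by
      intro k
      rw [Multiset.filter_cons]
      split_ifs <;> simp [mul_add]
    rw [Finset.sum_congr rfl fun k _ => hk k, Finset.sum_add_distrib, Multiset.map_cons,
      Multiset.sum_cons]
    exact add_le_add hb ih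

-- For each key, all bins but one are paid for by the volume `v` put into the bins of that key.
theorem sum_bins_le {S : Finset (K × ℤ)} {M : Multiset B} {g : K → ℝ} {v : B → ℝ}
    (hg : ∀ k, 0 ≤ g k) (hv : ∀ b, 0 ≤ v b)
    (hS : ∀ s ∈ S, 0 ≤ s.2 ∧ (s.2 : ℝ) ≤ ((M.filter (κ · = s.1)).map v).sum) :
    ∑ s ∈ S, g s.1 ≤
      ∑ k ∈ S.image Prod.fst, g k + (M.map fun b => g (κ b) * v b).sum := by
  have hfiber : ∀ k ∈ S.image Prod.fst, ∑ s ∈ S with s.1 = k, g s.1 ≤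
      g k + g k * ((M.filter (κ · = k)).map v).sum := by
    intro k _
    have hnonneg : 0 ≤ ((M.filter (κ · = k)).map v).sum :=
      Multiset.sum_nonneg (Multiset.forall_mem_map_iff.2 fun b _ => hv b)
    have hcard := card_le_of_snd_mem_Icc (S := S.filter (·.1 = k)) hnonneg fun s hs => by
      obtain ⟨hs, hk⟩ := Finset.mem_filter.1 hs
      exact ⟨hk, hk ▸ hS s hs⟩
    calc ∑ s ∈ S with s.1 = k, g s.1 = (S.filter (·.1 = k)).card * g k := by
          rw [Finset.sum_congr rfl fun s hs => by rw [(Finset.mem_filter.1 hs).2],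
            Finset.sum_const, nsmul_eq_mul]
      _ ≤ _ := by linarith [mul_le_mul_of_nonneg_right hcard (hg k)]
  calc ∑ s ∈ S, g s.1
      = ∑ k ∈ S.image Prod.fst, ∑ s ∈ S with s.1 = k, g s.1 :=
        (Finset.sum_fiberwise_of_maps_to (fun s hs => Finset.mem_image_of_mem _ hs) _).symm
    _ ≤ ∑ k ∈ S.image Prod.fst, (g k + g k * ((M.filter (κ · = k)).map v).sum) :=
        Finset.sum_le_sum hfiber
    _ ≤ _ := by
        rw [Finset.sum_add_distrib]
        exact add_le_add le_rfl (sum_mul_sum_filter_le hg hv)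

end Keys

theorem sum_half_pow_le (S : Finset ℕ) : ∑ b ∈ S, (1 / 2 : ℝ) ^ b ≤ 2 :=
  (summable_geometric_two.sum_le_tsum S fun _ _ => by positivity).trans_eq tsum_geometric_two

theorem sum_half_pow_prod_le (S : Finset (ℕ × ℕ)) :
    ∑ k ∈ S, (1 / 2 : ℝ) ^ k.1 * (1 / 2) ^ k.2 ≤ 4 := by
  calc ∑ k ∈ S, (1 / 2 : ℝ) ^ k.1 * (1 / 2) ^ k.2
      ≤ ∑ k ∈ S.image Prod.fst ×ˢ S.image Prod.snd, (1 / 2 : ℝ) ^ k.1 * (1 / 2) ^ k.2 := by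
        refine Finset.sum_le_sum_of_subset_of_nonneg Finset.subset_product fun _ _ _ => ?_
        positivity
    _ = (∑ a ∈ S.image Prod.fst, (1 / 2 : ℝ) ^ a) * ∑ b ∈ S.image Prod.snd, (1 / 2 : ℝ) ^ b := by
        rw [Finset.sum_product, Finset.sum_mul_sum]
    _ ≤ 2 * 2 := mul_le_mul (sum_half_pow_le _) (sum_half_pow_le _)
        (Finset.sum_nonneg fun _ _ => by positivity) (by norm_num)
    _ = 4 := by norm_num

/-- The dyadic class of a length: the number `a` with `X / 2 ^ (a + 1) < l ≤ X / 2 ^ a`. -/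
noncomputable def sizeClass (X l : ℝ) : ℕ := Nat.log 2 ⌊X / l⌋₊

theorem le_sizeClass {X l : ℝ} (hl : 0 < l) (hX : l ≤ X) : l ≤ X * (1 / 2) ^ sizeClass X l := by
  have h1 : 1 ≤ X / l := (one_le_div hl).2 hX
  have h2 : ⌊X / l⌋₊ ≠ 0 := (Nat.floor_pos.2 h1).ne'
  have h3 : ((2 ^ sizeClass X l : ℕ) : ℝ) ≤ X / l :=
    (Nat.cast_le.2 (Nat.pow_log_le_self 2 h2)).trans (Nat.floor_le (by linarith))
  rw [le_div_iff₀ hl] at h3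
  push_cast at h3
  rw [one_div, inv_pow, ← div_eq_mul_inv, le_div_iff₀ (by positivity)]
  linarith

theorem sizeClass_lt {X l : ℝ} (hl : 0 < l) : X * (1 / 2) ^ sizeClass X l < 2 * l := by
  have h3 : X / l < ((2 ^ (sizeClass X l + 1) : ℕ) : ℝ) := by
    refine (Nat.lt_floor_add_one _).trans_le ?_
    exact_mod_cast Nat.lt_pow_succ_log_self (by norm_num) ⌊X / l⌋₊
  rw [div_lt_iff₀ hl] at h3
  push_cast at h3
  rw [pow_succ] at h3
  rw [one_div, inv_pow, ← div_eq_mul_inv, div_lt_iff₀ (by positivity)]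
  linarith

section ShelfPacking

variable (X Y η : ℝ)

/-- The class of an L-shape, given by the dyadic classes of its arm lengths. -/
noncomputable def boxClass (L : LShape) : ℕ × ℕ := (sizeClass X L.lx, sizeClass Y L.ly)

/-- The fraction that `L` uses up of the diagonal of its box.  In a box of class `(a, b)` the lower
left corners lie on the segment from its lower left corner in the direction
`(η * X / 2 ^ a, Y / 2 ^ b)`. -/
noncomputable def load (L : LShape) : ℝ :=
  L.wx / (X * η * (1 / 2) ^ (boxClass X Y L).1) + L.wy / (Y * (1 / 2) ^ (boxClass X Y L).2)

/-- The total load of the shapes of `τ` in the class of `L`. -/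
noncomputable def fill (τ : List LShape) (L : LShape) : ℝ :=
  ((τ.filter (boxClass X Y · = boxClass X Y L)).map (load X Y η)).sum

/-- The box of the shape `L` arriving after `τ`: the boxes of each class are numbered in the order
in which they are filled. -/
noncomputable def box (τ : List LShape) (L : LShape) : (ℕ × ℕ) × ℤ :=
  (boxClass X Y L, ⌊fill X Y η τ L⌋)

/-- The horizontal position of a box in the sequence of all boxes of its height class, in units
of `X * η`.  The boxes of class `(a, b)` have the size
`((1 + η) * X / 2 ^ a, 2 * Y / 2 ^ b)`. -/
noncomputable def boxAbscissa (bs : List ((ℕ × ℕ) × ℤ)) (b : (ℕ × ℕ) × ℤ) : ℝ :=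
  offset (fun c => (1 + η) / η * (1 / 2) ^ c.1.1) (fun c => c.1.2) bs b

/-- The shelf of a box: the sequence of boxes of each height class is cut whenever it crosses a
multiple of `X * η`. -/
noncomputable def shelf (bs : List ((ℕ × ℕ) × ℤ)) (b : (ℕ × ℕ) × ℤ) : ℕ × ℤ :=
  (b.1.2, ⌊boxAbscissa η bs b⌋)

/-- The vertical position of the shelf of a box, in units of `Y`. -/
noncomputable def shelfOrdinate (bs : List ((ℕ × ℕ) × ℤ)) (b : (ℕ × ℕ) × ℤ) : ℝ :=
  offset (fun s => 2 * (1 / 2) ^ s.1) (fun _ => ()) (bs.map (shelf η bs)) (shelf η bs b)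

/-- The lower left corner of the box `b` in the packing of the boxes `bs`. -/
noncomputable def boxCorner (bs : List ((ℕ × ℕ) × ℤ)) (b : (ℕ × ℕ) × ℤ) : ℝ × ℝ :=
  (X * η * Int.fract (boxAbscissa η bs b), Y * shelfOrdinate η bs b)

/-- The position of the shape `L` arriving after `τ`, in the packing of the boxes `bs`. -/
noncomputable def positionIn (bs : List ((ℕ × ℕ) × ℤ)) (τ : List LShape) (L : LShape) : ℝ × ℝ :=
  boxCorner X Y η bs (box X Y η τ L) + Int.fract (fill X Y η τ L) •
    (X * η * (1 / 2) ^ (boxClass X Y L).1, Y * (1 / 2) ^ (boxClass X Y L).2)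

/-- The rule of online shelf packing into a rectangle of size `O(X) × O(Y / η)`, for shapes with
arm lengths at most `X` and `Y`. -/
noncomputable def shelfRule (τ : List LShape) (L : LShape) : ℝ × ℝ :=
  positionIn X Y η (trace (box X Y η) (τ ++ [L])) τ L

variable {X Y η} {bs cs : List ((ℕ × ℕ) × ℤ)} {b c : (ℕ × ℕ) × ℤ} {σ τ ρ : List LShape}
  {L K : LShape}

theorem boxCorner_eq_of_isPrefix (h : bs <+: cs) (hb : b ∈ bs) :
    boxCorner X Y η bs b = boxCorner X Y η cs b := by
  have habs : ∀ c ∈ bs, boxAbscissa η bs c = boxAbscissa η cs c :=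
    fun c hc => offset_eq_of_isPrefix h hc
  have hshelf : ∀ c ∈ bs, shelf η bs c = shelf η cs c := fun c hc => by
    rw [shelf, shelf, habs c hc]
  have hprefix : bs.map (shelf η bs) <+: cs.map (shelf η cs) := by
    rw [List.map_congr_left hshelf]
    exact h.map _
  rw [boxCorner, boxCorner, shelfOrdinate, shelfOrdinate, habs b hb, ← hshelf b hb,
    offset_eq_of_isPrefix hprefix (List.mem_map_of_mem hb)]

theorem shelfRule_eq_positionIn (h : τ ++ [L] <+: σ) :
    shelfRule X Y η τ L = positionIn X Y η (trace (box X Y η) σ) τ L := by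
  rw [shelfRule, positionIn, positionIn, boxCorner_eq_of_isPrefix (trace_isPrefix _ h)]
  exact mem_trace.2 ⟨τ, L, List.prefix_rfl, rfl⟩

theorem boxAbscissa_nonneg (hη : 0 < η) : 0 ≤ boxAbscissa η bs b :=
  offset_nonneg fun _ => by positivity

theorem boxCorner_nonneg (hX : 0 < X) (hY : 0 < Y) (hη : 0 < η) :
    0 ≤ (boxCorner X Y η bs b).1 ∧ 0 ≤ (boxCorner X Y η bs b).2 :=
  ⟨mul_nonneg (by positivity) (Int.fract_nonneg _),
    mul_nonneg hY.le (offset_nonneg fun _ => by positivity)⟩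

theorem boxCorner_left (hX : 0 < X) (hη : 0 < η) (hb : b ∈ bs)
    (hs : shelf η bs b = shelf η bs c) (h : Before bs b c) :
    (boxCorner X Y η bs b).1 + X * (1 + η) * (1 / 2) ^ b.1.1 ≤ (boxCorner X Y η bs c).1 := by
  have hoff : boxAbscissa η bs b + (1 + η) / η * (1 / 2) ^ b.1.1 ≤ boxAbscissa η bs c :=
    offset_add_le (fun _ => by positivity) hb (congrArg Prod.fst hs) h
  have hfloor : ⌊boxAbscissa η bs b⌋ = ⌊boxAbscissa η bs c⌋ := congrArg Prod.snd hs
  have hmul := mul_le_mul_of_nonneg_left hoff (mul_pos hX hη).le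
  have hcancel : X * η * ((1 + η) / η * (1 / 2) ^ b.1.1) = X * (1 + η) * (1 / 2) ^ b.1.1 := by
    field_simp
  rw [mul_add, hcancel] at hmul
  simp only [boxCorner, Int.fract, hfloor]
  linarith

theorem boxCorner_below (hY : 0 < Y) (hb : b ∈ bs)
    (h : Before (bs.map (shelf η bs)) (shelf η bs b) (shelf η bs c)) :
    (boxCorner X Y η bs b).2 + Y * (2 * (1 / 2) ^ b.1.2) ≤ (boxCorner X Y η bs c).2 := by
  rw [boxCorner, boxCorner, ← mul_add]
  exact mul_le_mul_of_nonneg_left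
    (offset_add_le (fun _ => by positivity) (List.mem_map_of_mem hb) rfl h) hY.le

theorem positionIn_inRect (hX : L.lx ≤ X) (hY : L.ly ≤ Y) (hη : 0 < η) :
    InRect L (positionIn X Y η bs τ L) (boxCorner X Y η bs (box X Y η τ L)).1
      ((boxCorner X Y η bs (box X Y η τ L)).1 + X * (1 + η) * (1 / 2) ^ (boxClass X Y L).1)
      (boxCorner X Y η bs (box X Y η τ L)).2
      ((boxCorner X Y η bs (box X Y η τ L)).2 + Y * (2 * (1 / 2) ^ (boxClass X Y L).2)) := by
  have hX0 := L.lx_pos.trans_le hX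
  have hY0 := L.ly_pos.trans_le hY
  have hlx : L.lx ≤ X * (1 / 2) ^ (boxClass X Y L).1 := le_sizeClass L.lx_pos hX
  have hly : L.ly ≤ Y * (1 / 2) ^ (boxClass X Y L).2 := le_sizeClass L.ly_pos hY
  have h0 := Int.fract_nonneg (fill X Y η τ L)
  have h1 := (Int.fract_lt_one (fill X Y η τ L)).le
  have hdx := mul_le_of_le_one_left
    (show 0 ≤ X * η * (1 / 2) ^ (boxClass X Y L).1 by positivity) h1
  have hdy := mul_le_of_le_one_left (show 0 ≤ Y * (1 / 2) ^ (boxClass X Y L).2 by positivity) h1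
  constructor <;> simp only [positionIn, Prod.fst_add, Prod.snd_add, Prod.smul_mk, smul_eq_mul]
  · exact le_add_of_nonneg_right (mul_nonneg h0 (by positivity))
  · linarith
  · exact le_add_of_nonneg_right (mul_nonneg h0 (by positivity))
  · linarith

theorem load_nonneg (hX : 0 < X) (hY : 0 < Y) (hη : 0 < η) (L : LShape) : 0 ≤ load X Y η L := by
  have := L.wx_pos; have := L.wy_pos
  unfold load; positivity

theorem fill_add_load_le (hX : 0 < X) (hY : 0 < Y) (hη : 0 < η)
    (hcls : boxClass X Y L = boxClass X Y K) (h : τ ++ [L] <+: ρ) :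
    fill X Y η τ L + load X Y η L ≤ fill X Y η ρ K := by
  have hsub := ((h.sublist.filter (boxClass X Y · = boxClass X Y K)).map
    (load X Y η)).sum_le_sum (List.forall_mem_map.2 fun L _ => load_nonneg hX hY hη L)
  simpa [fill, hcls] using hsub

theorem positionIn_precedes (hX : 0 < X) (hY : 0 < Y) (hη : 0 < η) (h : τ ++ [L] <+: ρ)
    (hbox : box X Y η τ L = box X Y η ρ K) :
    Precedes L (positionIn X Y η bs τ L) (positionIn X Y η bs ρ K) := by
  have hcls : boxClass X Y L = boxClass X Y K := congrArg Prod.fst hbox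
  have hfloor : ⌊fill X Y η τ L⌋ = ⌊fill X Y η ρ K⌋ := congrArg Prod.snd hbox
  have hload : load X Y η L ≤ Int.fract (fill X Y η ρ K) - Int.fract (fill X Y η τ L) := by
    have := fill_add_load_le hX hY hη hcls h
    simp only [Int.fract, hfloor]
    linarith
  have hx : L.wx / (X * η * (1 / 2) ^ (boxClass X Y L).1) ≤ load X Y η L := by
    have := L.wy_pos
    exact le_add_of_nonneg_right (by positivity)
  have hy : L.wy / (Y * (1 / 2) ^ (boxClass X Y L).2) ≤ load X Y η L := by
    have := L.wx_pos
    exact le_add_of_nonneg_left (by positivity)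
  replace hx := (div_le_iff₀ (by positivity)).1 (hx.trans hload)
  replace hy := (div_le_iff₀ (by positivity)).1 (hy.trans hload)
  refine .inr (.inr ?_)
  simp only [positionIn, ← hbox, ← hcls, Prod.fst_add, Prod.snd_add, Prod.smul_mk, smul_eq_mul]
  constructor <;> linarith

theorem shelfRule_separated (hσ : ∀ L ∈ σ, L.lx ≤ X ∧ L.ly ≤ Y) (hη : 0 < η)
    (hLρ : τ ++ [L] <+: ρ) (hKσ : ρ ++ [K] <+: σ) :
    Separated L (shelfRule X Y η τ L) K (shelfRule X Y η ρ K) := by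
  have hLσ : τ ++ [L] <+: σ := hLρ.trans ((List.prefix_append _ _).trans hKσ)
  obtain ⟨hLX, hLY⟩ := forall_mem_of_concat_isPrefix hσ hLσ
  obtain ⟨hKX, hKY⟩ := forall_mem_of_concat_isPrefix hσ hKσ
  have hX := L.lx_pos.trans_le hLX
  have hY := L.ly_pos.trans_le hLY
  rw [shelfRule_eq_positionIn hLσ, shelfRule_eq_positionIn hKσ]
  set bs := trace (box X Y η) σ
  have hb : box X Y η τ L ∈ bs := mem_trace.2 ⟨τ, L, hLσ, rfl⟩
  have hc : box X Y η ρ K ∈ bs := mem_trace.2 ⟨ρ, K, hKσ, rfl⟩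
  have hL := positionIn_inRect (bs := bs) (τ := τ) hLX hLY hη
  have hK := positionIn_inRect (bs := bs) (τ := ρ) hKX hKY hη
  rcases before_trichotomy (List.mem_map_of_mem (f := shelf η bs) hb)
    (c := shelf η bs (box X Y η ρ K)) with h | hshelf | h
  · exact hL.separated_of_below (hK.mono le_rfl le_rfl (boxCorner_below hY hb h) le_rfl)
  · rcases before_trichotomy hb (c := box X Y η ρ K) with h | h | h
    · exact hL.separated_of_left (hK.mono (boxCorner_left hX hη hb hshelf h) le_rfl le_rfl le_rfl)
    · exact .inl (positionIn_precedes hX hY hη hLρ h)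
    · exact (hK.separated_of_left
        (hL.mono (boxCorner_left hX hη hc hshelf.symm h) le_rfl le_rfl le_rfl)).symm
  · exact (hK.separated_of_below (hL.mono le_rfl le_rfl (boxCorner_below hY hc h) le_rfl)).symm

end ShelfPacking

section ShelfPackingSize

variable {X Y η : ℝ} {bs : List ((ℕ × ℕ) × ℤ)} {σ τ : List LShape} {L : LShape}

theorem half_pow_mul_load_le (hX : 0 < X) (hY : 0 < Y) (hη : 0 < η) (hη1 : η ≤ 1) (L : LShape) :
    (1 / 2) ^ (boxClass X Y L).1 * (1 / 2) ^ (boxClass X Y L).2 * load X Y η L ≤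
      4 / (η * X * Y) * L.area := by
  have hx : X * (1 / 2) ^ (boxClass X Y L).1 ≤ 2 * L.lx := (sizeClass_lt L.lx_pos).le
  have hy : Y * (1 / 2) ^ (boxClass X Y L).2 ≤ 2 * L.ly := (sizeClass_lt L.ly_pos).le
  have := L.wx_pos
  have := L.wy_pos
  have := L.lx_pos
  unfold load
  generalize (boxClass X Y L).1 = a at *
  generalize (boxClass X Y L).2 = b at *
  have hspine : L.wx * (Y * (1 / 2) ^ b) ≤ 2 * L.area :=
    (mul_le_mul_of_nonneg_left hy L.wx_pos.le).trans (by linarith [L.wx_mul_ly_le_area])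
  have hfoot : η * (L.wy * (X * (1 / 2) ^ a)) ≤ 2 * L.area :=
    calc η * (L.wy * (X * (1 / 2) ^ a)) ≤ 1 * (L.wy * (2 * L.lx)) := by gcongr
      _ ≤ 2 * L.area := by linarith [L.lx_mul_wy_le_area]
  calc (1 / 2 : ℝ) ^ a * (1 / 2) ^ b * (L.wx / (X * η * (1 / 2) ^ a) + L.wy / (Y * (1 / 2) ^ b))
      = 1 / (η * X * Y) * (L.wx * (Y * (1 / 2) ^ b) + η * (L.wy * (X * (1 / 2) ^ a))) := by
        field_simp
    _ ≤ 1 / (η * X * Y) * (2 * L.area + 2 * L.area) := by gcongr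
    _ = 4 / (η * X * Y) * L.area := by ring

theorem fill_nonneg (hX : 0 < X) (hY : 0 < Y) (hη : 0 < η) : 0 ≤ fill X Y η τ L :=
  List.sum_nonneg (List.forall_mem_map.2 fun L _ => load_nonneg hX hY hη L)

theorem fill_le_of_isPrefix (hX : 0 < X) (hY : 0 < Y) (hη : 0 < η) (h : τ <+: σ) :
    fill X Y η τ L ≤ fill X Y η σ L :=
  ((h.sublist.filter _).map _).sum_le_sum (List.forall_mem_map.2 fun L _ => load_nonneg hX hY hη L)

theorem sum_boxes_le (hX : 0 < X) (hY : 0 < Y) (hη : 0 < η) (hη1 : η ≤ 1)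
    (hA : totalArea σ ≤ η * X * Y) :
    ∑ b ∈ (trace (box X Y η) σ).toFinset, (1 / 2 : ℝ) ^ b.1.1 * (1 / 2) ^ b.1.2 ≤ 8 := by
  have hbins := sum_bins_le (S := (trace (box X Y η) σ).toFinset) (M := (σ : Multiset LShape))
    (κ := boxClass X Y) (g := fun k => (1 / 2 : ℝ) ^ k.1 * (1 / 2) ^ k.2) (v := load X Y η)
    (fun _ => by positivity) (load_nonneg hX hY hη) fun b hb => by
      obtain ⟨τ, L, h, rfl⟩ := mem_trace.1 (List.mem_toFinset.1 hb)
      refine ⟨Int.floor_nonneg.2 (fill_nonneg hX hY hη), (Int.floor_le _).trans ?_⟩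
      exact fill_le_of_isPrefix hX hY hη ((List.prefix_append _ _).trans h)
  have hload : (σ.map fun L => (1 / 2) ^ (boxClass X Y L).1 * (1 / 2) ^ (boxClass X Y L).2 *
      load X Y η L).sum ≤ 4 :=
    calc _ ≤ (σ.map fun L => 4 / (η * X * Y) * L.area).sum :=
          List.sum_le_sum fun L _ => half_pow_mul_load_le hX hY hη hη1 L
      _ = 4 / (η * X * Y) * totalArea σ := List.sum_map_mul_left _ _ _
      _ ≤ 4 / (η * X * Y) * (η * X * Y) := by gcongr
      _ = 4 := div_mul_cancel₀ _ (by positivity)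
  calc _ ≤ _ := hbins
    _ ≤ 4 + 4 := add_le_add (sum_half_pow_prod_le _) hload
    _ = 8 := by norm_num

theorem sum_shelves_le (hη : 0 < η) :
    ∑ s ∈ (bs.map (shelf η bs)).toFinset, 2 * (1 / 2 : ℝ) ^ s.1 ≤
      4 + 2 * ((1 + η) / η) * ∑ b ∈ bs.toFinset, (1 / 2 : ℝ) ^ b.1.1 * (1 / 2) ^ b.1.2 := by
  have hbins := sum_bins_le (S := (bs.map (shelf η bs)).toFinset) (M := bs.toFinset.val)
    (κ := fun b => b.1.2) (g := fun k => 2 * (1 / 2 : ℝ) ^ k)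
    (v := fun b => (1 + η) / η * (1 / 2) ^ b.1.1) (fun _ => by positivity)
    (fun _ => by positivity) fun s hs => by
      obtain ⟨b, -, rfl⟩ := List.mem_map.1 (List.mem_toFinset.1 hs)
      refine ⟨Int.floor_nonneg.2 (boxAbscissa_nonneg hη), (Int.floor_le _).trans ?_⟩
      exact offset_le_sum fun _ => by positivity
  refine hbins.trans (add_le_add ?_ (le_of_eq ?_))
  · rw [← Finset.mul_sum]
    linarith [sum_half_pow_le ((bs.map (shelf η bs)).toFinset.image Prod.fst)]
  · rw [Finset.mul_sum]
    exact Finset.sum_congr rfl fun b _ => by ring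

theorem boxCorner_inRect (hX : 0 < X) (hY : 0 < Y) (hη : 0 < η) (hη1 : η ≤ 1)
    (hA : totalArea σ ≤ η * X * Y) {b : (ℕ × ℕ) × ℤ} (hb : b ∈ trace (box X Y η) σ) :
    (boxCorner X Y η (trace (box X Y η) σ) b).1 + X * (1 + η) * (1 / 2) ^ b.1.1 ≤
        (1 + 2 * η) * X ∧
      (boxCorner X Y η (trace (box X Y η) σ) b).2 + Y * (2 * (1 / 2) ^ b.1.2) ≤ 36 / η * Y := by
  constructor
  · have hfract := mul_le_of_le_one_right (mul_pos hX hη).le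
      (Int.fract_lt_one (boxAbscissa η (trace (box X Y η) σ) b)).le
    have hpow := mul_le_of_le_one_right (show 0 ≤ X * (1 + η) by positivity)
      (pow_le_one₀ (n := b.1.1) (show (0 : ℝ) ≤ 1 / 2 by norm_num) (by norm_num))
    simp only [boxCorner]
    linarith
  · have hone : 1 ≤ 1 / η := (one_le_div hη).2 hη1
    rw [boxCorner, ← mul_add, mul_comm]
    refine mul_le_mul_of_nonneg_right ?_ hY.le
    calc _ ≤ _ := offset_add_le_sum (fun _ => by positivity) (List.mem_map_of_mem hb)
      _ ≤ _ := sum_shelves_le hη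
      _ ≤ 4 + 2 * ((1 + η) / η) * 8 := by
        gcongr
        exact sum_boxes_le hX hY hη hη1 hA
      _ = 20 + 16 * (1 / η) := by field_simp; ring
      _ ≤ 36 * (1 / η) := by linarith
      _ = 36 / η := by ring

theorem shelfRule_inRect (hη : 0 < η) (hη1 : η ≤ 1) (hσ : ∀ L ∈ σ, L.lx ≤ X ∧ L.ly ≤ Y)
    (hA : totalArea σ ≤ η * X * Y) (h : τ ++ [L] <+: σ) :
    InRect L (shelfRule X Y η τ L) 0 ((1 + 2 * η) * X) 0 (36 / η * Y) := by
  obtain ⟨hLX, hLY⟩ := forall_mem_of_concat_isPrefix hσ h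
  have hX := L.lx_pos.trans_le hLX
  have hY := L.ly_pos.trans_le hLY
  obtain ⟨hright, htop⟩ := boxCorner_inRect hX hY hη hη1 hA (mem_trace.2 ⟨τ, L, h, rfl⟩)
  obtain ⟨hleft, hbottom⟩ := boxCorner_nonneg (bs := trace (box X Y η) σ)
    (b := box X Y η τ L) hX hY hη
  rw [shelfRule_eq_positionIn h]
  exact (positionIn_inRect hLX hLY hη).mono hleft hright hbottom htop

end ShelfPackingSize

section BoundingBox

variable {σ : List LShape} {P : Fin σ.length → ℝ × ℝ} {S C : Set (ℝ × ℝ)} {w h : ℝ}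

theorem isCompact_occupied : IsCompact (occupied σ P) :=
  isCompact_iUnion fun _ => LShape.isCompact_region _ _

theorem subset_boundingBox (hS : IsCompact S) :
    S ⊆ Set.Icc (sInf (Prod.fst '' S)) (sSup (Prod.fst '' S)) ×ˢ
      Set.Icc (sInf (Prod.snd '' S)) (sSup (Prod.snd '' S)) := by
  have hfst := hS.image continuous_fst
  have hsnd := hS.image continuous_snd
  exact fun z hz => ⟨⟨csInf_le hfst.bddBelow ⟨z, hz, rfl⟩, le_csSup hfst.bddAbove ⟨z, hz, rfl⟩⟩,
    csInf_le hsnd.bddBelow ⟨z, hz, rfl⟩, le_csSup hsnd.bddAbove ⟨z, hz, rfl⟩⟩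

theorem sub_le_bbWidth (hS : IsCompact S) {p q : ℝ × ℝ} (hp : p ∈ S) (hq : q ∈ S) :
    q.1 - p.1 ≤ bbWidth S :=
  sub_le_sub (subset_boundingBox hS hq).1.2 (subset_boundingBox hS hp).1.1

theorem sub_le_bbHeight (hS : IsCompact S) {p q : ℝ × ℝ} (hp : p ∈ S) (hq : q ∈ S) :
    q.2 - p.2 ≤ bbHeight S :=
  sub_le_sub (subset_boundingBox hS hq).2.2 (subset_boundingBox hS hp).2.1

theorem bbWidth_nonneg (hS : IsCompact S) : 0 ≤ bbWidth S := by
  rcases S.eq_empty_or_nonempty with rfl | ⟨z, hz⟩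
  · simp [bbWidth]
  · simpa using sub_le_bbWidth hS hz hz

theorem bbHeight_nonneg (hS : IsCompact S) : 0 ≤ bbHeight S := by
  rcases S.eq_empty_or_nonempty with rfl | ⟨z, hz⟩
  · simp [bbHeight]
  · simpa using sub_le_bbHeight hS hz hz

theorem bbWidth_le (hS : S ⊆ Set.Icc 0 w ×ˢ Set.Icc 0 h) (hw : 0 ≤ w) : bbWidth S ≤ w := by
  have hsup : sSup (Prod.fst '' S) ≤ w :=
    Real.sSup_le (Set.forall_mem_image.2 fun z hz => (hS hz).1.2) hw
  have hinf : 0 ≤ sInf (Prod.fst '' S) :=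
    Real.sInf_nonneg (Set.forall_mem_image.2 fun z hz => (hS hz).1.1)
  unfold bbWidth; linarith

theorem bbHeight_le (hS : S ⊆ Set.Icc 0 w ×ˢ Set.Icc 0 h) (hh : 0 ≤ h) : bbHeight S ≤ h := by
  have hsup : sSup (Prod.snd '' S) ≤ h :=
    Real.sSup_le (Set.forall_mem_image.2 fun z hz => (hS hz).2.2) hh
  have hinf : 0 ≤ sInf (Prod.snd '' S) :=
    Real.sInf_nonneg (Set.forall_mem_image.2 fun z hz => (hS hz).2.1)
  unfold bbHeight; linarith

theorem arms_le_boundingBox {L : LShape} (hL : L ∈ σ) :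
    L.lx ≤ bbWidth (occupied σ P) ∧ L.ly ≤ bbHeight (occupied σ P) := by
  obtain ⟨i, rfl⟩ := List.get_of_mem hL
  have hmem : ∀ {z}, z ∈ (σ.get i).region (P i) → z ∈ occupied σ P :=
    fun hz => Set.mem_iUnion.2 ⟨i, hz⟩
  have hcorner := hmem (LShape.corner_mem_region _ _)
  have hx := sub_le_bbWidth isCompact_occupied hcorner (hmem (LShape.right_mem_region _ _))
  have hy := sub_le_bbHeight isCompact_occupied hcorner (hmem (LShape.top_mem_region _ _))
  rw [add_sub_cancel_left] at hx hy
  exact ⟨hx, hy⟩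

open MeasureTheory in
theorem IsPacking.totalArea_le (hP : IsPacking C σ P) :
    totalArea σ ≤ bbWidth (occupied σ P) * bbHeight (occupied σ P) := by
  have hW := bbWidth_nonneg (isCompact_occupied (σ := σ) (P := P))
  have hH := bbHeight_nonneg (isCompact_occupied (σ := σ) (P := P))
  have htotal : totalArea σ = ∑ i, (σ.get i).area :=
    (Fin.sum_univ_fun_getElem σ LShape.area).symm
  rw [htotal, ← ENNReal.ofReal_le_ofReal_iff (mul_nonneg hW hH),
    ENNReal.ofReal_sum_of_nonneg fun i _ => (σ.get i).area_pos.le]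
  calc ∑ i, ENNReal.ofReal (σ.get i).area
      ≤ ∑ i, volume (interior ((σ.get i).region (P i))) :=
        Finset.sum_le_sum fun i _ => (σ.get i).area_le_volume (P i)
    _ = volume (⋃ i, interior ((σ.get i).region (P i))) := by
        rw [measure_iUnion hP.2 fun i => isOpen_interior.measurableSet, tsum_fintype]
    _ ≤ volume (_ ×ˢ _) := measure_mono <|
        (Set.iUnion_mono fun i => interior_subset).trans (subset_boundingBox isCompact_occupied)
    _ = ENNReal.ofReal (bbWidth (occupied σ P)) * ENNReal.ofReal (bbHeight (occupied σ P)) := by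
        rw [Measure.volume_eq_prod, Measure.prod_prod, Real.volume_Icc, Real.volume_Icc]
        rfl
    _ = _ := (ENNReal.ofReal_mul hW).symm

theorem Variant.Solves.le_opt {V : Variant} {𝒜 : OnlineAlgorithm} (h𝒜 : V.Solves 𝒜) {c : ℝ}
    (h : ∀ P, IsPacking V.container σ P → c ≤ V.cost (occupied σ P)) : c ≤ V.opt σ :=
  le_csInf ⟨_, _, h𝒜 σ, rfl⟩ fun _ ⟨P, hP, hc⟩ => hc ▸ h P hP

theorem occupied_subset_of_forall {f : List LShape → LShape → ℝ × ℝ}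
    (h : ∀ τ L, τ ++ [L] <+: σ → L.region (f τ L) ⊆ C) :
    occupied σ ((ofRule f).run σ) ⊆ C := by
  refine Set.iUnion_subset fun i => ?_
  rw [run_ofRule]
  exact h _ _ (take_concat_get_isPrefix σ i)

end BoundingBox

section Doubling

variable {σ τ ρ : List LShape} {L K : LShape}

/-- The larger of the longest arm and the square root of the total area: up to a constant factor,
the size of a square into which `σ` can be packed. -/
noncomputable def scale (σ : List LShape) : ℝ :=
  σ.foldr (fun L c => max (max L.lx L.ly) c) √(totalArea σ)

theorem scale_le_iff {c : ℝ} :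
    scale σ ≤ c ↔ (∀ L ∈ σ, L.lx ≤ c ∧ L.ly ≤ c) ∧ √(totalArea σ) ≤ c := by
  rw [scale]
  generalize √(totalArea σ) = r
  induction σ with
  | nil => simp
  | cons L σ ih => simp only [List.foldr_cons, max_le_iff, ih, List.forall_mem_cons, and_assoc]

theorem scale_nonneg (σ : List LShape) : 0 ≤ scale σ :=
  (Real.sqrt_nonneg _).trans (scale_le_iff.1 le_rfl).2

theorem scale_pos (hL : L ∈ σ) : 0 < scale σ :=
  L.lx_pos.trans_le ((scale_le_iff.1 le_rfl).1 L hL).1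

theorem scale_le_of_isPrefix (h : τ <+: σ) : scale τ ≤ scale σ := by
  obtain ⟨harms, harea⟩ := scale_le_iff.1 (le_refl (scale σ))
  exact scale_le_iff.2 ⟨fun L hL => harms L (h.subset hL),
    (Real.sqrt_le_sqrt (totalArea_le_of_sublist h.sublist)).trans harea⟩

theorem scale_sq_le (σ : List LShape) : scale σ ^ 2 ≤ 1 + totalArea σ := by
  have h0 := totalArea_nonneg σ
  have hone : 1 ≤ √(1 + totalArea σ) := Real.one_le_sqrt.2 (by linarith)
  refine (Real.le_sqrt (scale_nonneg σ) (by linarith)).1 (scale_le_iff.2 ⟨fun L _ => ?_, ?_⟩)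
  · exact ⟨L.lx_le_one.trans hone, L.ly_le_one.trans hone⟩
  · exact Real.sqrt_le_sqrt (by linarith)

theorem IsPacking.scale_le {C : Set (ℝ × ℝ)} {P : Fin σ.length → ℝ × ℝ}
    (hP : IsPacking C σ P) :
    scale σ ≤ bbWidth (occupied σ P) + bbHeight (occupied σ P) := by
  have hW := bbWidth_nonneg (isCompact_occupied (σ := σ) (P := P))
  have hH := bbHeight_nonneg (isCompact_occupied (σ := σ) (P := P))
  refine scale_le_iff.2 ⟨fun L hL => ?_, Real.sqrt_le_iff.2 ⟨by linarith, ?_⟩⟩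
  · obtain ⟨hx, hy⟩ := arms_le_boundingBox (P := P) hL
    constructor <;> linarith
  · nlinarith [hP.totalArea_le]

/-- The exponent of the smallest power of two that is at least the scale. -/
noncomputable def phase (σ : List LShape) : ℤ := Int.clog 2 (scale σ)

theorem scale_le_two_zpow_phase (σ : List LShape) : scale σ ≤ 2 ^ phase σ := by
  exact_mod_cast Int.self_le_zpow_clog (b := 2) (by norm_num) (scale σ)

theorem two_zpow_phase_le (hL : L ∈ σ) : (2 : ℝ) ^ phase σ ≤ 2 * scale σ := by
  have h : (2 : ℝ) ^ (phase σ - 1) < scale σ := by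
    exact_mod_cast Int.zpow_pred_clog_lt_self (b := 2) (by norm_num) (scale_pos hL)
  rw [zpow_sub_one₀ two_ne_zero] at h
  linarith

theorem phase_le_of_isPrefix (hL : L ∈ τ) (h : τ <+: σ) : phase τ ≤ phase σ :=
  Int.clog_mono_right (scale_pos hL) (scale_le_of_isPrefix h)

/-- The rule of shelf packing into a square of side `O(2 ^ k)`, for phase `k`; the regions of
different phases are disjoint.  In each phase the shapes of the earlier ones are taken into account
as if they had been packed in this region, too. -/
noncomputable def doublingRule (τ : List LShape) (L : LShape) : ℝ × ℝ :=
  (3 * 2 ^ phase (τ ++ [L]), 0) +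
    shelfRule (2 ^ phase (τ ++ [L])) (2 ^ phase (τ ++ [L])) 1 τ L

theorem arms_le_two_zpow_phase (h : L ∈ σ) : L.lx ≤ 2 ^ phase σ ∧ L.ly ≤ 2 ^ phase σ :=
  (scale_le_iff.1 (scale_le_two_zpow_phase σ)).1 L h

theorem doublingRule_inRect (τ : List LShape) (L : LShape) :
    InRect L (doublingRule τ L) (3 * 2 ^ phase (τ ++ [L])) (6 * 2 ^ phase (τ ++ [L])) 0
      (36 * 2 ^ phase (τ ++ [L])) := by
  have harea := (scale_le_iff.1 (scale_le_two_zpow_phase (τ ++ [L]))).2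
  rw [Real.sqrt_le_left (by positivity), sq] at harea
  have hshelf := shelfRule_inRect one_pos le_rfl (fun _ => arms_le_two_zpow_phase)
    (by rwa [one_mul]) (List.prefix_refl (τ ++ [L]))
  refine (hshelf.translate _).mono ?_ ?_ ?_ ?_ <;> simp only <;> linarith

theorem doublingRule_separated (h : τ ++ [L] <+: ρ) (K : LShape) :
    Separated L (doublingRule τ L) K (doublingRule ρ K) := by
  have hprefix := h.trans (List.prefix_append ρ [K])
  rcases (phase_le_of_isPrefix (L := L) (by simp) hprefix).eq_or_lt with heq | hlt
  · rw [doublingRule, heq]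
    exact (shelfRule_separated (fun _ => arms_le_two_zpow_phase) one_pos h
      List.prefix_rfl).translate _
  · have htwice : (2 : ℝ) ^ (phase (τ ++ [L]) + 1) ≤ 2 ^ phase (ρ ++ [K]) :=
      zpow_le_zpow_right₀ one_le_two (by lia)
    rw [zpow_add_one₀ two_ne_zero] at htwice
    exact (doublingRule_inRect τ L).separated_of_left
      ((doublingRule_inRect ρ K).mono (by linarith) le_rfl le_rfl le_rfl)

theorem doublingRule_isPacking (σ : List LShape) :
    IsPacking Set.univ σ ((ofRule doublingRule).run σ) :=
  isPacking_ofRule (fun _ _ _ => Set.subset_univ _)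
    fun _ _ _ K hL _ => doublingRule_separated hL K

theorem occupied_doublingRule_subset (σ : List LShape) :
    occupied σ ((ofRule doublingRule).run σ) ⊆
      Set.Icc 0 (12 * scale σ) ×ˢ Set.Icc 0 (72 * scale σ) := by
  refine occupied_subset_of_forall fun τ L h => ?_
  have hphase : 2 ^ phase (τ ++ [L]) ≤ 2 * scale σ :=
    (two_zpow_phase_le (L := L) (by simp)).trans (by linarith [scale_le_of_isPrefix h])
  refine ((doublingRule_inRect τ L).mono ?_ ?_ le_rfl ?_).region_subset
  · positivity
  · linarith
  · linarith

theorem bbWidth_doublingRule_le (σ : List LShape) :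
    bbWidth (occupied σ ((ofRule doublingRule).run σ)) ≤ 12 * scale σ :=
  bbWidth_le (occupied_doublingRule_subset σ) (by linarith [scale_nonneg σ])

theorem bbHeight_doublingRule_le (σ : List LShape) :
    bbHeight (occupied σ ((ofRule doublingRule).run σ)) ≤ 72 * scale σ :=
  bbHeight_le (occupied_doublingRule_subset σ) (by linarith [scale_nonneg σ])

theorem exists_periPack_hasCompetitiveRatio_const :
    ∃ (C : ℝ) (𝒜 : OnlineAlgorithm), periPack.Solves 𝒜 ∧
      periPack.HasCompetitiveRatio 𝒜 (fun _ => C) := by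
  have hsolves : periPack.Solves (ofRule doublingRule) := doublingRule_isPacking
  refine ⟨84, ofRule doublingRule, hsolves, fun σ => ?_⟩
  have hopt : 2 * scale σ ≤ periPack.opt σ :=
    hsolves.le_opt fun P hP => mul_le_mul_of_nonneg_left hP.scale_le zero_le_two
  have hW := bbWidth_doublingRule_le σ
  have hH := bbHeight_doublingRule_le σ
  simp only [Variant.algCost, periPack] at hopt ⊢
  linarith

theorem totalArea_le_sqrt_mul_opt {𝒜 : OnlineAlgorithm} (h𝒜 : areaPack.Solves 𝒜)
    (σ : List LShape) : totalArea σ ≤ √σ.length * areaPack.opt σ := by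
  rcases eq_or_ne σ [] with rfl | hσ
  · simp [totalArea]
  have hopt : totalArea σ ≤ areaPack.opt σ := h𝒜.le_opt fun P hP => hP.totalArea_le
  have hone : 1 ≤ √(σ.length : ℝ) :=
    Real.one_le_sqrt.2 (by exact_mod_cast List.length_pos_iff.2 hσ)
  exact hopt.trans (le_mul_of_one_le_left ((totalArea_nonneg σ).trans hopt) hone)

theorem exists_areaPack_hasAsymptoticCompetitiveRatio_sqrt :
    ∃ (C : ℝ) (𝒜 : OnlineAlgorithm), areaPack.Solves 𝒜 ∧
      areaPack.HasAsymptoticCompetitiveRatio 𝒜 (fun n => C * √n) := by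
  have hsolves : areaPack.Solves (ofRule doublingRule) := doublingRule_isPacking
  refine ⟨864, ofRule doublingRule, hsolves, 864, by norm_num, fun σ => ?_⟩
  calc areaPack.algCost (ofRule doublingRule) σ
      ≤ 12 * scale σ * (72 * scale σ) :=
        mul_le_mul (bbWidth_doublingRule_le σ) (bbHeight_doublingRule_le σ)
          (bbHeight_nonneg isCompact_occupied) (by linarith [scale_nonneg σ])
    _ = 864 * scale σ ^ 2 := by ring
    _ ≤ 864 * (1 + √σ.length * areaPack.opt σ) := by
        linarith [scale_sq_le σ, totalArea_le_sqrt_mul_opt hsolves σ]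
    _ = 864 * √σ.length * areaPack.opt σ + 864 := by ring

end Doubling

section UnitSquare

variable {δ : ℝ} {σ τ ρ : List LShape} {L K : LShape}

/-- The arm length up to which a shape counts as flat in the packing of the unit square: flat
shapes of small total area fit in a strip of width `δ / 4`. -/
noncomputable def flatness (δ : ℝ) : ℝ := δ ^ 2 / 576

theorem flatness_pos (hδ : 0 < δ) : 0 < flatness δ := by unfold flatness; positivity

/-- The online rule that packs flat shapes into the strip `[δ / 4, 1] × [0, δ / 4]`. -/
noncomputable def flatRule (δ : ℝ) (τ : List LShape) (L : LShape) : ℝ × ℝ :=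
  (δ / 4, 0) + shelfRule (1 - δ) (flatness δ) (δ / 4) τ L

theorem flatRule_inRect (hδ : 0 < δ) (hδ' : δ ≤ 1 / 2)
    (hσ : ∀ L ∈ σ, L.lx ≤ 1 - δ ∧ L.ly ≤ flatness δ) (hA : totalArea σ ≤ flatness δ * δ / 8)
    (h : τ ++ [L] <+: σ) : InRect L (flatRule δ τ L) (δ / 4) 1 0 (δ / 4) := by
  have hθ := flatness_pos hδ
  have hA' : totalArea σ ≤ δ / 4 * (1 - δ) * flatness δ :=
    hA.trans (by nlinarith [mul_pos hθ hδ])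
  have hheight : 36 / (δ / 4) * flatness δ = δ / 4 := by unfold flatness; field_simp; norm_num
  refine ((shelfRule_inRect (by linarith) (by linarith) hσ hA' h).translate (δ / 4, 0)).mono
    (by simp) ?_ (by simp) (by simp [hheight])
  have := sq_nonneg δ
  linarith

theorem flatRule_separated (hδ : 0 < δ) (hσ : ∀ L ∈ σ, L.lx ≤ 1 - δ ∧ L.ly ≤ flatness δ)
    (hLρ : τ ++ [L] <+: ρ) (hKσ : ρ ++ [K] <+: σ) :
    Separated L (flatRule δ τ L) K (flatRule δ ρ K) :=
  (shelfRule_separated hσ (by linarith) hLρ hKσ).translate _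

/-- The next corner of a staircase in which every shape starts at the inner corner of the
preceding one. -/
noncomputable def staircase (τ : List LShape) : ℝ × ℝ :=
  ((τ.map LShape.wx).sum, (τ.map LShape.wy).sum)

theorem staircase_separated (hLρ : τ ++ [L] <+: ρ) :
    Separated L (staircase τ) K (staircase ρ) :=
  .inl (.inr (.inr ⟨sum_add_le_of_concat_isPrefix (fun M => M.wx_pos.le) hLρ,
    sum_add_le_of_concat_isPrefix (fun M => M.wy_pos.le) hLρ⟩))

/-- The online rule for the unit square: flat shapes go to a strip along the bottom, transposed
flat shapes to a strip along the left, and all others form a staircase. -/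
noncomputable def squareRule (δ : ℝ) (τ : List LShape) (L : LShape) : ℝ × ℝ :=
  if L.ly ≤ flatness δ then flatRule δ (τ.filter (·.ly ≤ flatness δ)) L
  else if L.lx ≤ flatness δ then
    (flatRule δ ((τ.filter (·.lx ≤ flatness δ)).map LShape.transpose) L.transpose).swap
  else (δ / 4, δ / 4) + staircase (τ.filter fun K => flatness δ < K.lx ∧ flatness δ < K.ly)

theorem mul_sum_le_totalArea {θ : ℝ} {w : LShape → ℝ} (h : ∀ M ∈ σ, θ * w M ≤ M.area) :
    θ * (σ.map w).sum ≤ totalArea σ := by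
  rw [totalArea, ← List.sum_map_mul_left]
  exact List.sum_le_sum h

section Zones

theorem arms_le_of_mem_filter (hσ : ∀ L ∈ σ, L.lx ≤ 1 - δ ∧ L.ly ≤ 1 - δ) :
    ∀ L ∈ σ.filter (·.ly ≤ flatness δ), L.lx ≤ 1 - δ ∧ L.ly ≤ flatness δ := by
  simpa only [List.mem_filter, decide_eq_true_eq] using
    fun L (hL : L ∈ σ ∧ _) => And.intro (hσ L hL.1).1 hL.2

theorem arms_le_of_mem_map_transpose (hσ : ∀ L ∈ σ, L.lx ≤ 1 - δ ∧ L.ly ≤ 1 - δ) :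
    ∀ L ∈ (σ.filter (·.lx ≤ flatness δ)).map LShape.transpose,
      L.lx ≤ 1 - δ ∧ L.ly ≤ flatness δ := by
  simpa only [List.forall_mem_map, List.mem_filter, decide_eq_true_eq, LShape.transpose] using
    fun L (hL : L ∈ σ ∧ _) => And.intro (hσ L hL.1).2 hL.2

theorem squareRule_separated_of_wide (hδ : 0 < δ) (hσ : ∀ L ∈ σ, L.lx ≤ 1 - δ ∧ L.ly ≤ 1 - δ)
    (hLρ : τ ++ [L] <+: ρ) (hKσ : ρ ++ [K] <+: σ) (hL : L.ly ≤ flatness δ)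
    (hK : K.ly ≤ flatness δ) : Separated L (squareRule δ τ L) K (squareRule δ ρ K) := by
  rw [squareRule, squareRule, if_pos hL, if_pos hK]
  exact flatRule_separated hδ (arms_le_of_mem_filter hσ)
    (filter_concat_isPrefix hLρ (by simpa)) (filter_concat_isPrefix hKσ (by simpa))

theorem squareRule_separated_of_tall (hδ : 0 < δ) (hσ : ∀ L ∈ σ, L.lx ≤ 1 - δ ∧ L.ly ≤ 1 - δ)
    (hLρ : τ ++ [L] <+: ρ) (hKσ : ρ ++ [K] <+: σ)
    (hLy : ¬L.ly ≤ flatness δ) (hLx : L.lx ≤ flatness δ) (hKy : ¬K.ly ≤ flatness δ)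
    (hKx : K.lx ≤ flatness δ) : Separated L (squareRule δ τ L) K (squareRule δ ρ K) := by
  rw [squareRule, squareRule, if_neg hLy, if_neg hKy, if_pos hLx, if_pos hKx]
  exact Separated.transpose <| flatRule_separated hδ (arms_le_of_mem_map_transpose hσ)
    (map_concat_isPrefix _ (filter_concat_isPrefix hLρ (by simpa)))
    (map_concat_isPrefix _ (filter_concat_isPrefix hKσ (by simpa)))

theorem squareRule_separated_of_thick (hLρ : τ ++ [L] <+: ρ)
    (hLy : ¬L.ly ≤ flatness δ) (hLx : ¬L.lx ≤ flatness δ) (hKy : ¬K.ly ≤ flatness δ)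
    (hKx : ¬K.lx ≤ flatness δ) : Separated L (squareRule δ τ L) K (squareRule δ ρ K) := by
  rw [squareRule, squareRule, if_neg hLy, if_neg hKy, if_neg hLx, if_neg hKx]
  exact (staircase_separated
    (filter_concat_isPrefix hLρ (by simpa using ⟨not_le.1 hLx, not_le.1 hLy⟩))).translate _

variable (hδ : 0 < δ) (hσ : ∀ L ∈ σ, L.lx ≤ 1 - δ ∧ L.ly ≤ 1 - δ)
  (hA : totalArea σ ≤ flatness δ * δ / 8)
include hδ hσ hA

theorem squareRule_inRect_of_wide (hδ' : δ ≤ 1 / 2) (h : τ ++ [L] <+: σ)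
    (hL : L.ly ≤ flatness δ) : InRect L (squareRule δ τ L) (δ / 4) 1 0 (δ / 4) := by
  rw [squareRule, if_pos hL]
  exact flatRule_inRect hδ hδ' (arms_le_of_mem_filter hσ)
    ((totalArea_le_of_sublist List.filter_sublist).trans hA)
    (filter_concat_isPrefix h (by simpa))

theorem squareRule_inRect_of_tall (hδ' : δ ≤ 1 / 2) (h : τ ++ [L] <+: σ)
    (hLy : ¬L.ly ≤ flatness δ) (hLx : L.lx ≤ flatness δ) :
    InRect L (squareRule δ τ L) 0 (δ / 4) (δ / 4) 1 := by
  rw [squareRule, if_neg hLy, if_pos hLx]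
  have hA' : totalArea ((σ.filter (·.lx ≤ flatness δ)).map LShape.transpose) ≤
      flatness δ * δ / 8 := by
    rw [totalArea, List.map_map, show LShape.area ∘ LShape.transpose = LShape.area from
      funext LShape.area_transpose]
    exact (totalArea_le_of_sublist List.filter_sublist).trans hA
  exact InRect.transpose <| flatRule_inRect hδ hδ' (arms_le_of_mem_map_transpose hσ) hA'
    (map_concat_isPrefix _ (filter_concat_isPrefix h (by simpa)))

theorem squareRule_inRect_of_thick (h : τ ++ [L] <+: σ) (hLy : ¬L.ly ≤ flatness δ)
    (hLx : ¬L.lx ≤ flatness δ) : InRect L (squareRule δ τ L) (δ / 4) 1 (δ / 4) 1 := by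
  have hθ := flatness_pos hδ
  obtain ⟨hLX, hLY⟩ := forall_mem_of_concat_isPrefix hσ h
  rw [squareRule, if_neg hLy, if_neg hLx]
  set ν := τ.filter fun K => flatness δ < K.lx ∧ flatness δ < K.ly
  have hthick : ∀ M ∈ ν, flatness δ < M.lx ∧ flatness δ < M.ly :=
    fun M hM => by simpa using List.of_mem_filter hM
  have hνA : totalArea ν ≤ flatness δ * δ / 8 := (totalArea_le_of_sublist
    (List.filter_sublist.trans ((List.prefix_append _ _).trans h).sublist)).trans hA
  have hwidth : (ν.map LShape.wx).sum ≤ δ / 8 := by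
    refine le_of_mul_le_mul_left ?_ hθ
    refine ((mul_sum_le_totalArea fun M hM => ?_).trans hνA).trans_eq (by ring)
    rw [mul_comm]
    exact (mul_le_mul_of_nonneg_left (hthick M hM).2.le M.wx_pos.le).trans M.wx_mul_ly_le_area
  have hheight : (ν.map LShape.wy).sum ≤ δ / 8 := by
    refine le_of_mul_le_mul_left ?_ hθ
    refine ((mul_sum_le_totalArea fun M hM => ?_).trans hνA).trans_eq (by ring)
    exact (mul_le_mul_of_nonneg_right (hthick M hM).1.le M.wy_pos.le).trans M.lx_mul_wy_le_area
  have hwx : 0 ≤ (ν.map LShape.wx).sum :=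
    List.sum_nonneg (by simpa using fun M _ => M.wx_pos.le)
  have hwy : 0 ≤ (ν.map LShape.wy).sum :=
    List.sum_nonneg (by simpa using fun M _ => M.wy_pos.le)
  constructor <;> simp only [staircase, Prod.fst_add, Prod.snd_add] <;> linarith

theorem squareRule_inRect (hδ' : δ ≤ 1 / 2) (h : τ ++ [L] <+: σ) :
    InRect L (squareRule δ τ L) 0 1 0 1 := by
  by_cases hLy : L.ly ≤ flatness δ
  · exact (squareRule_inRect_of_wide hδ hσ hA hδ' h hLy).mono (by linarith) le_rfl le_rfl
      (by linarith)
  by_cases hLx : L.lx ≤ flatness δ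
  · exact (squareRule_inRect_of_tall hδ hσ hA hδ' h hLy hLx).mono le_rfl (by linarith)
      (by linarith) le_rfl
  · exact (squareRule_inRect_of_thick hδ hσ hA h hLy hLx).mono (by linarith) le_rfl
      (by linarith) le_rfl

theorem squareRule_separated (hδ' : δ ≤ 1 / 2) (hLρ : τ ++ [L] <+: ρ) (hKσ : ρ ++ [K] <+: σ) :
    Separated L (squareRule δ τ L) K (squareRule δ ρ K) := by
  have hLσ : τ ++ [L] <+: σ := hLρ.trans ((List.prefix_append _ _).trans hKσ)
  have wide {υ M} := squareRule_inRect_of_wide hδ hσ hA hδ' (τ := υ) (L := M)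
  have tall {υ M} := squareRule_inRect_of_tall hδ hσ hA hδ' (τ := υ) (L := M)
  have thick {υ M} := squareRule_inRect_of_thick hδ hσ hA (τ := υ) (L := M)
  by_cases hLy : L.ly ≤ flatness δ <;> by_cases hKy : K.ly ≤ flatness δ
  · exact squareRule_separated_of_wide hδ hσ hLρ hKσ hLy hKy
  · have hL := wide hLσ hLy
    by_cases hKx : K.lx ≤ flatness δ
    · exact ((tall hKσ hKy hKx).separated_of_left hL).symm
    · exact hL.separated_of_below (thick hKσ hKy hKx)
  · have hK := wide hKσ hKy
    by_cases hLx : L.lx ≤ flatness δ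
    · exact (tall hLσ hLy hLx).separated_of_left hK
    · exact (hK.separated_of_below (thick hLσ hLy hLx)).symm
  · by_cases hLx : L.lx ≤ flatness δ <;> by_cases hKx : K.lx ≤ flatness δ
    · exact squareRule_separated_of_tall hδ hσ hLρ hKσ hLy hLx hKy hKx
    · exact (tall hLσ hLy hLx).separated_of_left (thick hKσ hKy hKx)
    · exact ((tall hKσ hKy hKx).separated_of_left (thick hLσ hLy hLx)).symm
    · exact squareRule_separated_of_thick hLρ hLy hLx hKy hKx

end Zones

theorem packsUnitSquare_squareRule (hδ : 0 < δ) (hδ' : δ ≤ 1 / 2) :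
    PacksUnitSquare (ofRule (squareRule δ)) (1 - δ) (flatness δ * δ / 8) := fun _ hσ hA =>
  isPacking_ofRule (fun _ _ h => (squareRule_inRect hδ hσ hA hδ' h).region_subset)
    fun _ _ _ _ => squareRule_separated hδ hσ hA hδ'

theorem PacksUnitSquare.mono {𝒜 : OnlineAlgorithm} {s t A : ℝ} (h : PacksUnitSquare 𝒜 t A)
    (hst : s ≤ t) : PacksUnitSquare 𝒜 s A := fun σ hσ =>
  h σ fun L hL => ⟨(hσ L hL).1.trans hst, (hσ L hL).2.trans hst⟩

theorem onlineCriticalDensity_pos {t : ℝ} (ht : t < 1) : 0 < onlineCriticalDensity t := by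
  obtain ⟨δ, hδ, hδt⟩ : ∃ δ, 0 < δ ∧ δ ≤ min (1 - t) (1 / 2) :=
    ⟨_, lt_min (sub_pos.2 ht) one_half_pos, le_rfl⟩
  obtain ⟨htδ, hδ'⟩ := le_min_iff.1 hδt
  have hA : 0 < flatness δ * δ / 8 := by have := flatness_pos hδ; positivity
  have hpacks : PacksUnitSquare (ofRule (squareRule δ)) t (flatness δ * δ / 8).toNNReal := by
    rw [Real.coe_toNNReal _ hA.le]
    exact (packsUnitSquare_squareRule hδ hδ').mono (by linarith)
  exact (ENNReal.coe_pos.2 (Real.toNNReal_pos.2 hA)).trans_le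
    (le_biSup (fun A : ℝ≥0 => (A : ℝ≥0∞)) ⟨_, hpacks⟩)

theorem corner_eq_zero_of_region_subset {p : ℝ × ℝ} (hx : L.lx = 1) (hy : L.ly = 1)
    (h : L.region p ⊆ Set.Icc 0 1 ×ˢ Set.Icc 0 1) : p = 0 := by
  obtain ⟨⟨hx₀, -⟩, hy₀, -⟩ := h (L.corner_mem_region p)
  obtain ⟨⟨-, hx₁⟩, -⟩ := h (L.right_mem_region p)
  obtain ⟨-, -, hy₁⟩ := h (L.top_mem_region p)
  rw [hx] at hx₁
  rw [hy] at hy₁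
  exact Prod.ext (le_antisymm (by simpa using hx₁) hx₀) (le_antisymm (by simpa using hy₁) hy₀)

theorem not_packsUnitSquare_one {A : ℝ} (hA : 0 < A) (𝒜 : OnlineAlgorithm) :
    ¬PacksUnitSquare 𝒜 1 A := by
  intro h
  obtain ⟨w, hw, hwA⟩ : ∃ w, 0 < w ∧ w ≤ min (A / 4) 1 :=
    ⟨_, lt_min (by linarith) one_pos, le_rfl⟩
  obtain ⟨hwA, hw1⟩ := le_min_iff.1 hwA
  let L : LShape := ⟨1, 1, w, w, hw, hw, hw1, hw1, le_rfl, le_rfl⟩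
  have harea : ([L, L].map LShape.area).sum ≤ A := by
    have := mul_pos hw hw
    simp only [List.map_cons, List.map_nil, List.sum_cons, List.sum_nil, LShape.area, L]
    linarith
  obtain ⟨hsub, hdisj⟩ := h [L, L] (by simp [L]) harea
  have h0 : 𝒜.run [L, L] (0 : Fin 2) = 0 := corner_eq_zero_of_region_subset rfl rfl (hsub 0)
  have h1 : 𝒜.run [L, L] (1 : Fin 2) = 0 := corner_eq_zero_of_region_subset rfl rfl (hsub 1)
  have hd : Disjoint (interior (L.region (𝒜.run [L, L] (0 : Fin 2))))
      (interior (L.region (𝒜.run [L, L] (1 : Fin 2)))) :=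
    hdisj (show (0 : Fin 2) ≠ 1 by decide)
  rw [h0, h1] at hd
  have hmem : (1 / 2, w / 2) ∈ interior (L.region 0) :=
    L.foot_subset_interior 0 ⟨by norm_num [L], by constructor <;> simp [L, hw]⟩
  exact Set.disjoint_left.1 hd hmem hmem

theorem onlineCriticalDensity_one : onlineCriticalDensity 1 = 0 := by
  refine le_antisymm (iSup₂_le fun A ⟨𝒜, h𝒜⟩ => ?_) zero_le
  by_contra! hA
  exact not_packsUnitSquare_one (NNReal.coe_pos.2 (ENNReal.coe_pos.1 hA)) 𝒜 h𝒜

end UnitSquare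

section Squeezing

variable {w : ℝ} {x : List ℕ → ℕ → ℝ} {ks : List ℕ} {k lo hi lo' hi' : ℕ} {l r : ℕ → ℝ}

/-- The online placement `x` of numbered points on the half-line `[0, ∞)`, where `x ks k` is the
position of point `k` after the points `ks`, sorts the points in every cell `[m, m + 1)`: larger
numbers go to the left, at distance at least `w`. -/
structure SortsCells (w : ℝ) (x : List ℕ → ℕ → ℝ) : Prop where
  nonneg : ∀ ks k, 0 ≤ x ks k
  right_of_lt : ∀ {ks k ks' k'}, ks ++ [k] <+: ks' → ⌊x ks' k'⌋₊ = ⌊x ks k⌋₊ → k' < k →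
    x ks k + w ≤ x ks' k'
  left_of_lt : ∀ {ks k ks' k'}, ks ++ [k] <+: ks' → ⌊x ks' k'⌋₊ = ⌊x ks k⌋₊ → k < k' →
    x ks' k' + w ≤ x ks k

/-- The number of the points `ks` that the online placement `x` puts into the cell
`[m, m + 1)`. -/
noncomputable def cellCount (x : List ℕ → ℕ → ℝ) (ks : List ℕ) (m : ℕ) : ℕ :=
  (trace (fun τ k => ⌊x τ k⌋₊) ks).count m

theorem cellCount_concat_self : cellCount x (ks ++ [k]) ⌊x ks k⌋₊ =
    cellCount x ks ⌊x ks k⌋₊ + 1 := by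
  rw [cellCount, trace_concat, List.count_append, List.count_singleton_self, cellCount]

theorem cellCount_concat_of_ne {m : ℕ} (hm : m ≠ ⌊x ks k⌋₊) :
    cellCount x (ks ++ [k]) m = cellCount x ks m := by
  rw [cellCount, trace_concat, List.count_append, List.count_singleton, cellCount, if_neg, add_zero]
  simpa using hm.symm

/-- The position of the bisecting adversary after the points `ks`: numbers strictly between `lo`
and `hi` are unused, and the points with these numbers are confined, in the cell `[m, m + 1)`, to
the interval from `l m` to `r m`, from whose ends they keep distance `w`. -/
structure Squeezed (w : ℝ) (x : List ℕ → ℕ → ℝ) (ks : List ℕ) (lo hi : ℕ) (l r : ℕ → ℝ) :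
    Prop where
  nodup : ks.Nodup
  fresh : ∀ k ∈ ks, k ∉ Set.Ioo lo hi
  confined : ∀ ks' k, ks <+: ks' → k ∈ Set.Ioo lo hi →
    l ⌊x ks' k⌋₊ + w ≤ x ks' k ∧ x ks' k + w ≤ r ⌊x ks' k⌋₊
  width_le : ∀ m, (r m - l m) * 2 ^ cellCount x ks m ≤ 1 + 2 * w
  count_le : ∀ m, w * 2 ^ cellCount x ks m ≤ 1 + 2 * w

theorem SortsCells.squeezed_nil (hx : SortsCells w x) (hw : 0 ≤ w) :
    Squeezed w x [] lo hi (fun m => m - w) (fun m => m + 1 + w) where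
  nodup := List.nodup_nil
  fresh := by simp
  confined ks k _ _ := by
    have hfloor := Nat.floor_le (hx.nonneg ks k)
    have hlt := (Nat.lt_floor_add_one (x ks k)).le
    constructor <;> linarith
  width_le m := by simp only [cellCount, trace_nil, List.count_nil]; linarith
  count_le m := by simp only [cellCount, trace_nil, List.count_nil]; linarith

theorem Squeezed.concat (h : Squeezed w x ks lo hi l r) {l₀ r₀ : ℝ} (hk : k ∈ Set.Ioo lo hi)
    (hsub : Set.Ioo lo' hi' ⊆ Set.Ioo lo hi) (hk' : k ∉ Set.Ioo lo' hi')
    (hconfined : ∀ ks' k', ks ++ [k] <+: ks' → k' ∈ Set.Ioo lo' hi' →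
      ⌊x ks' k'⌋₊ = ⌊x ks k⌋₊ → l₀ + w ≤ x ks' k' ∧ x ks' k' + w ≤ r₀)
    (hhalf : (r₀ - l₀) * 2 ≤ r ⌊x ks k⌋₊ - l ⌊x ks k⌋₊) :
    Squeezed w x (ks ++ [k]) lo' hi' (Function.update l ⌊x ks k⌋₊ l₀)
      (Function.update r ⌊x ks k⌋₊ r₀) where
  nodup := List.nodup_append.2 ⟨h.nodup, List.nodup_singleton k, fun a ha b hb => by
    rw [List.mem_singleton.1 hb]
    exact fun hak => h.fresh a ha (hak ▸ hk)⟩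
  fresh := by
    simp only [List.mem_append, List.mem_singleton]
    rintro j (hj | rfl)
    exacts [fun hj' => h.fresh j hj (hsub hj'), hk']
  confined ks' k' hks hk₁ := by
    by_cases hm : ⌊x ks' k'⌋₊ = ⌊x ks k⌋₊
    · rw [hm, Function.update_self, Function.update_self]
      exact hconfined ks' k' hks hk₁ hm
    · rw [Function.update_of_ne hm, Function.update_of_ne hm]
      exact h.confined ks' k' ((List.prefix_append _ _).trans hks) (hsub hk₁)
  width_le m := by
    obtain rfl | hm := eq_or_ne m ⌊x ks k⌋₊
    · rw [Function.update_self, Function.update_self, cellCount_concat_self, pow_succ', ← mul_assoc]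
      exact (mul_le_mul_of_nonneg_right hhalf (by positivity)).trans (h.width_le _)
    · rw [Function.update_of_ne hm, Function.update_of_ne hm, cellCount_concat_of_ne hm]
      exact h.width_le m
  count_le m := by
    obtain rfl | hm := eq_or_ne m ⌊x ks k⌋₊
    · obtain ⟨hleft, hright⟩ := h.confined ks k List.prefix_rfl hk
      rw [cellCount_concat_self, pow_succ', ← mul_assoc]
      exact (mul_le_mul_of_nonneg_right (by linarith) (by positivity)).trans (h.width_le _)
    · rw [cellCount_concat_of_ne hm]
      exact h.count_le m

theorem Squeezed.exists_concat (h : Squeezed w x ks lo hi l r) (hx : SortsCells w x)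
    (hk : k ∈ Set.Ioo lo hi) :
    ∃ l' r', Squeezed w x (ks ++ [k]) k hi l' r' ∨ Squeezed w x (ks ++ [k]) lo k l' r' := by
  have hprefix : ∀ {ks'}, ks ++ [k] <+: ks' → ks <+: ks' := (List.prefix_append _ _).trans
  rcases le_total (x ks k - l ⌊x ks k⌋₊) (r ⌊x ks k⌋₊ - x ks k) with hle | hle
  · have hsub : Set.Ioo k hi ⊆ Set.Ioo lo hi := Set.Ioo_subset_Ioo_left hk.1.le
    refine ⟨_, _, .inl (h.concat (l₀ := l ⌊x ks k⌋₊) (r₀ := x ks k) hk hsub (by simp)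
      (fun ks' k' hks hk' hm => ⟨?_, hx.left_of_lt hks hm hk'.1⟩) (by linarith))⟩
    exact hm ▸ (h.confined ks' k' (hprefix hks) (hsub hk')).1
  · have hsub : Set.Ioo lo k ⊆ Set.Ioo lo hi := Set.Ioo_subset_Ioo_right hk.2.le
    refine ⟨_, _, .inr (h.concat (l₀ := x ks k) (r₀ := r ⌊x ks k⌋₊) hk hsub (by simp)
      (fun ks' k' hks hk' hm => ⟨hx.right_of_lt hks hm hk'.2, ?_⟩) (by linarith))⟩
    exact hm ▸ (h.confined ks' k' (hprefix hks) (hsub hk')).2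

theorem SortsCells.exists_squeezed (hx : SortsCells w x) (hw : 0 ≤ w) (n e : ℕ) :
    ∃ ks lo l r, ks.length = n ∧ Squeezed w x ks lo (lo + 2 ^ e) l r := by
  induction n generalizing e with
  | zero => exact ⟨[], 0, _, _, rfl, hx.squeezed_nil hw⟩
  | succ n ih =>
    obtain ⟨ks, lo, l, r, hlen, h⟩ := ih (e + 1)
    have hpos : 0 < 2 ^ e := by positivity
    obtain ⟨l', r', h' | h'⟩ := h.exists_concat hx (k := lo + 2 ^ e)
      ⟨by lia, by rw [pow_succ]; lia⟩
    · rw [pow_succ, mul_two, ← add_assoc] at h'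
      exact ⟨_, _, l', r', by simp [hlen], h'⟩
    · exact ⟨_, _, l', r', by simp [hlen], h'⟩

theorem SortsCells.exists_cellCount_le (hx : SortsCells w x) (hw : 0 ≤ w) (n : ℕ) :
    ∃ ks : List ℕ, ks.length = n ∧ ks.Nodup ∧ ∀ m, w * 2 ^ cellCount x ks m ≤ 1 + 2 * w := by
  obtain ⟨ks, lo, l, r, hlen, h⟩ := hx.exists_squeezed hw n 0
  exact ⟨ks, hlen, h.nodup, h.count_le⟩

theorem length_le_of_cellCount_le {B M : ℕ} (hB : ∀ m, cellCount x ks m ≤ B)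
    (hM : ∀ τ k, τ ++ [k] <+: ks → ⌊x τ k⌋₊ ≤ M) : ks.length ≤ (M + 1) * B := by
  set cells := trace (fun τ k => ⌊x τ k⌋₊) ks with hcells
  have hsub : cells.toFinset ⊆ Finset.range (M + 1) := fun m hm => by
    obtain ⟨τ, k, h, rfl⟩ := mem_trace.1 (List.mem_toFinset.1 hm)
    exact Finset.mem_range_succ_iff.2 (hM τ k h)
  calc ks.length = ∑ m ∈ cells.toFinset, cells.count m := by
        rw [List.sum_toFinset_count_eq_length, hcells, length_trace]
    _ ≤ cells.toFinset.card * B := Finset.sum_le_card_nsmul _ _ _ fun m _ => hB m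
    _ ≤ (M + 1) * B :=
      Nat.mul_le_mul_right _ ((Finset.card_le_card hsub).trans_eq (Finset.card_range _))

end Squeezing

section StripPacking

variable {V : Variant} {𝒜 : OnlineAlgorithm} {σ τ ρ : List LShape} {L K : LShape}
  {S : Set (ℝ × ℝ)} {P : Fin σ.length → ℝ × ℝ} {n k l : ℕ} {p q : ℝ × ℝ}

theorem exists_run_eq (h : τ ++ [L] <+: σ) :
    ∃ i : Fin σ.length, i = τ.length ∧ σ.get i = L ∧ 𝒜.run σ i = 𝒜 (τ ++ [L]) := by
  obtain ⟨ρ, rfl⟩ := h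
  refine ⟨⟨τ.length, by simp⟩, rfl, by simp, ?_⟩
  rw [OnlineAlgorithm.run, List.take_left' (by simp)]

theorem Variant.Solves.region_subset (h : V.Solves 𝒜) (τ : List LShape) (L : LShape) :
    L.region (𝒜 (τ ++ [L])) ⊆ V.container := by
  obtain ⟨i, -, hi, hrun⟩ := exists_run_eq (𝒜 := 𝒜) (List.prefix_refl (τ ++ [L]))
  have hsub := (h (τ ++ [L])).1 i
  rwa [hi, hrun] at hsub

theorem Variant.Solves.disjoint_interior (h : V.Solves 𝒜) (hLρ : τ ++ [L] <+: ρ) :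
    Disjoint (interior (L.region (𝒜 (τ ++ [L])))) (interior (K.region (𝒜 (ρ ++ [K])))) := by
  obtain ⟨i, hi, hL, hrun⟩ := exists_run_eq (𝒜 := 𝒜) (hLρ.trans (List.prefix_append ρ [K]))
  obtain ⟨j, hj, hK, hrun'⟩ := exists_run_eq (𝒜 := 𝒜) (List.prefix_refl (ρ ++ [K]))
  have hlen := hLρ.length_le
  rw [List.length_append, List.length_singleton] at hlen
  have hij : i ≠ j := Fin.ne_of_lt (by rw [Fin.lt_def]; lia)
  have hdisj := (h _).2 hij
  dsimp only at hdisj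
  rwa [hL, hK, hrun, hrun'] at hdisj

theorem fst_le_algCost_stripPack (h : τ ++ [L] <+: σ) :
    (𝒜 (τ ++ [L])).1 ≤ stripPack.algCost 𝒜 σ := by
  obtain ⟨i, -, -, hrun⟩ := exists_run_eq (𝒜 := 𝒜) h
  rw [← hrun]
  exact (subset_boundingBox isCompact_occupied
    (Set.mem_iUnion.2 ⟨i, LShape.corner_mem_region _ _⟩)).1.2

theorem stripPack_cost_nonneg (hS : S ⊆ stripPack.container) : 0 ≤ stripPack.cost S :=
  Real.sSup_nonneg (Set.forall_mem_image.2 fun _ hz => (hS hz).1)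

theorem opt_stripPack_nonneg (σ : List LShape) : 0 ≤ stripPack.opt σ :=
  Real.sInf_nonneg fun _ ⟨_, hP, hc⟩ => hc ▸ stripPack_cost_nonneg (Set.iUnion_subset hP.1)

theorem opt_stripPack_le {c : ℝ} (hc : 0 ≤ c) (hP : IsPacking (Set.Icc 0 c ×ˢ Set.Icc 0 1) σ P) :
    stripPack.opt σ ≤ c := by
  have hcost : stripPack.cost (occupied σ P) ≤ c :=
    Real.sSup_le (Set.forall_mem_image.2 fun _ hz => (Set.iUnion_subset hP.1 hz).1.2) hc
  have hcontainer : ∀ i, (σ.get i).region (P i) ⊆ stripPack.container := fun i =>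
    (hP.1 i).trans (Set.prod_mono_left Set.Icc_subset_Ici_self)
  have hbdd : BddBelow
      {c | ∃ P, IsPacking stripPack.container σ P ∧ c = stripPack.cost (occupied σ P)} := by
    refine ⟨0, ?_⟩
    rintro _ ⟨Q, hQ, rfl⟩
    exact stripPack_cost_nonneg (Set.iUnion_subset hQ.1)
  exact (csInf_le hbdd ⟨P, ⟨hcontainer, hP.2⟩, rfl⟩).trans hcost

/-- The `k`-th shape available to the adversary who presents `n` shapes: the foot has length `1`
and thickness `2 ^ (-k - 1)`, and the spine, of thickness `1 / (n + 1)`, leaves vertical room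
`2 ^ (-k - 1)` in the strip. -/
noncomputable def keyShape (n k : ℕ) : LShape where
  lx := 1
  ly := 1 - (1 / 2) ^ (k + 1)
  wx := 1 / (n + 1)
  wy := (1 / 2) ^ (k + 1)
  wx_pos := by positivity
  wy_pos := by positivity
  wx_le := (div_le_one (by positivity)).2 (by simp)
  wy_le := by
    have := pow_le_one₀ (n := k) (show (0 : ℝ) ≤ 1 / 2 by norm_num) (by norm_num)
    rw [pow_succ]; linarith
  lx_le_one := le_rfl
  ly_le_one := by simp

theorem half_pow_le_of_lt {k l : ℕ} (h : k < l) : (1 / 2 : ℝ) ^ l ≤ (1 / 2) ^ (k + 1) :=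
  pow_le_pow_of_le_one (by norm_num) (by norm_num) h

theorem not_disjoint_of_Ioo_prod_subset {A B : Set (ℝ × ℝ)} {a b c d a' b' c' d' : ℝ}
    (hA : Set.Ioo a b ×ˢ Set.Ioo c d ⊆ A) (hB : Set.Ioo a' b' ×ˢ Set.Ioo c' d' ⊆ B)
    (hx : max a a' < min b b') (hy : max c c' < min d d') : ¬Disjoint A B := by
  obtain ⟨x, hax, hxb⟩ := exists_between hx
  obtain ⟨y, hcy, hyd⟩ := exists_between hy
  rw [max_lt_iff] at hax hcy
  rw [lt_min_iff] at hxb hyd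
  exact Set.not_disjoint_iff.2 ⟨(x, y), hA ⟨⟨hax.1, hxb.1⟩, hcy.1, hyd.1⟩,
    hB ⟨⟨hax.2, hxb.2⟩, hcy.2, hyd.2⟩⟩

theorem snd_mem_Icc_of_region_subset (h : (keyShape n k).region p ⊆ stripPack.container) :
    p.2 ∈ Set.Icc 0 ((1 / 2) ^ (k + 1)) := by
  have htop : p.2 + (1 - (1 / 2) ^ (k + 1)) ≤ 1 := (h (LShape.top_mem_region _ p)).2.2
  exact ⟨(h (LShape.corner_mem_region _ p)).2.1, by linarith⟩

theorem keyShape_left_of_lt (hkl : k < l) (hp : (keyShape n k).region p ⊆ stripPack.container)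
    (hq : (keyShape n l).region q ⊆ stripPack.container)
    (hdisj : Disjoint (interior ((keyShape n k).region p)) (interior ((keyShape n l).region q)))
    (hqp : q.1 < p.1 + 1) : q.1 + 1 / (n + 1) ≤ p.1 := by
  obtain ⟨hp₀, hp₁⟩ := snd_mem_Icc_of_region_subset hp
  obtain ⟨hq₀, hq₁⟩ := snd_mem_Icc_of_region_subset hq
  have hw : (0 : ℝ) < 1 / (n + 1) := by positivity
  have hl : (0 : ℝ) < (1 / 2) ^ (l + 1) := by positivity
  have hk : (1 / 2 : ℝ) ^ (k + 1) ≤ 1 / 2 := by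
    simpa using half_pow_le_of_lt (Nat.succ_pos k)
  have hlk := half_pow_le_of_lt hkl
  have hl' : (1 / 2 : ℝ) ^ (l + 1) = (1 / 2) ^ l / 2 := by rw [pow_succ]; ring
  -- Otherwise the spine of the taller shape `l` meets the spine or the foot of `k`.
  by_contra! hlt
  rcases lt_or_ge q.1 (p.1 + 1 / (n + 1)) with _ | _
  · refine not_disjoint_of_Ioo_prod_subset (LShape.spine_subset_interior _ p)
      (LShape.spine_subset_interior _ q) ?_ ?_ hdisj <;>
    · simp only [keyShape, max_lt_iff, lt_min_iff]
      refine ⟨⟨?_, ?_⟩, ?_, ?_⟩ <;> linarith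
  · refine not_disjoint_of_Ioo_prod_subset (LShape.foot_subset_interior _ p)
      (LShape.spine_subset_interior _ q) ?_ ?_ hdisj <;>
    · simp only [keyShape, max_lt_iff, lt_min_iff]
      refine ⟨⟨?_, ?_⟩, ?_, ?_⟩ <;> linarith

/-- The abscissa at which `𝒜` places the `k`-th key shape, arriving after those listed in
`ks`. -/
noncomputable def keyAbscissa (𝒜 : OnlineAlgorithm) (n : ℕ) (ks : List ℕ) (k : ℕ) : ℝ :=
  (𝒜 (ks.map (keyShape n) ++ [keyShape n k])).1

theorem lt_add_one_of_floor_eq {a b : ℝ} (hb : 0 ≤ b) (h : ⌊a⌋₊ = ⌊b⌋₊) : a < b + 1 :=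
  (Nat.lt_floor_add_one a).trans_le (by rw [h]; linarith [Nat.floor_le hb])

theorem sortsCells_keyAbscissa (h𝒜 : stripPack.Solves 𝒜) (n : ℕ) :
    SortsCells (1 / (n + 1)) (keyAbscissa 𝒜 n) := by
  have hsub := fun ks k => h𝒜.region_subset (List.map (keyShape n) ks) (keyShape n k)
  have hnonneg : ∀ ks k, 0 ≤ keyAbscissa 𝒜 n ks k := fun ks k =>
    (hsub ks k (LShape.corner_mem_region _ _)).1
  have hdisj := fun {ks : List ℕ} {k : ℕ} {ks' : List ℕ} (k' : ℕ) (h : ks ++ [k] <+: ks') =>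
    h𝒜.disjoint_interior (K := keyShape n k') (map_concat_isPrefix (keyShape n) h)
  refine ⟨hnonneg, fun {ks k ks' k'} h hcell hlt => ?_, fun {ks k ks' k'} h hcell hlt => ?_⟩
  · exact keyShape_left_of_lt hlt (hsub _ _) (hsub _ _) (hdisj k' h).symm
      (lt_add_one_of_floor_eq (hnonneg _ _) hcell.symm)
  · exact keyShape_left_of_lt hlt (hsub _ _) (hsub _ _) (hdisj k' h)
      (lt_add_one_of_floor_eq (hnonneg _ _) hcell)

/-- The position of the `k`-th key shape in an offline packing of the key shapes listed in
`ks`. -/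
noncomputable def keyCorner (n : ℕ) (ks : List ℕ) (k : ℕ) : ℝ × ℝ :=
  ((ks.toFinset.filter (k < ·)).card / (n + 1), (1 / 2) ^ (k + 1))

theorem keyCorner_precedes {ks : List ℕ} (hl : l ∈ ks) (hkl : k < l) :
    Precedes (keyShape n l) (keyCorner n ks l) (keyCorner n ks k) := by
  have hcard : (ks.toFinset.filter (l < ·)).card < (ks.toFinset.filter (k < ·)).card := by
    refine Finset.card_lt_card (Finset.ssubset_iff.2 ⟨l, by simp, ?_⟩)
    rw [Finset.insert_subset_iff]
    exact ⟨by simp [hl, hkl], Finset.monotone_filter_right _ fun _ _ hj => hkl.trans hj⟩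
  refine .inr (.inr ⟨?_, ?_⟩) <;> simp only [keyShape, keyCorner]
  · rw [← add_div]
    gcongr
    exact_mod_cast hcard
  · calc _ = (1 / 2 : ℝ) ^ l := by rw [pow_succ]; ring
      _ ≤ _ := half_pow_le_of_lt hkl

theorem keyCorner_inRect {ks : List ℕ} (hlen : ks.length ≤ n) (k : ℕ) :
    InRect (keyShape n k) (keyCorner n ks k) 0 2 0 1 := by
  have hcard : (ks.toFinset.filter (k < ·)).card ≤ n :=
    (Finset.card_filter_le _ _).trans ((List.toFinset_card_le ks).trans hlen)
  have hcard' : ((ks.toFinset.filter (k < ·)).card / (n + 1) : ℝ) ≤ 1 :=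
    (div_le_one (by positivity)).2 (by exact_mod_cast hcard.trans n.le_succ)
  constructor <;> simp only [keyShape, keyCorner]
  · positivity
  · linarith
  · positivity
  · linarith

theorem opt_keyShape_le {ks : List ℕ} (hlen : ks.length ≤ n) (hks : ks.Nodup) :
    stripPack.opt (ks.map (keyShape n)) ≤ 2 := by
  refine opt_stripPack_le zero_le_two (isPacking_map hks
    (fun k _ => (keyCorner_inRect hlen k).region_subset) fun k hk l hl hne => ?_)
  rcases hne.lt_or_gt with hkl | hlk
  exacts [.inr (keyCorner_precedes hl hkl), .inl (keyCorner_precedes hk hlk)]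

theorem exists_hard_sequence (h𝒜 : stripPack.Solves 𝒜) (n : ℕ) :
    ∃ σ : List LShape, σ.length = n ∧ stripPack.opt σ ≤ 2 ∧
      (n : ℝ) ≤ (stripPack.algCost 𝒜 σ + 1) * Nat.log 2 (n + 3) := by
  have hx := sortsCells_keyAbscissa h𝒜 n
  obtain ⟨ks, hlen, hks, hcount⟩ := hx.exists_cellCount_le (by positivity) n
  refine ⟨ks.map (keyShape n), by simp [hlen], opt_keyShape_le hlen.le hks, ?_⟩
  have hlog : ∀ m, cellCount (keyAbscissa 𝒜 n) ks m ≤ Nat.log 2 (n + 3) := fun m => by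
    have h := hcount m
    rw [one_div_mul_eq_div, div_le_iff₀ (by positivity)] at h
    field_simp at h
    refine Nat.le_log_of_pow_le one_lt_two ?_
    have h' : (2 : ℝ) ^ cellCount (keyAbscissa 𝒜 n) ks m ≤ n + 3 := by linarith
    exact_mod_cast h'
  have hcost : 0 ≤ stripPack.algCost 𝒜 (ks.map (keyShape n)) :=
    stripPack_cost_nonneg (Set.iUnion_subset (h𝒜 _).1)
  have hM : ∀ τ k, τ ++ [k] <+: ks → ⌊keyAbscissa 𝒜 n τ k⌋₊ ≤
      ⌊stripPack.algCost 𝒜 (ks.map (keyShape n))⌋₊ := fun τ k h =>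
    Nat.floor_le_floor (fst_le_algCost_stripPack (map_concat_isPrefix _ h))
  have hn := length_le_of_cellCount_le hlog hM
  calc (n : ℝ) ≤ (⌊stripPack.algCost 𝒜 (ks.map (keyShape n))⌋₊ + 1) * Nat.log 2 (n + 3) := by
        rw [hlen] at hn
        exact_mod_cast hn
    _ ≤ _ := by gcongr; exact Nat.floor_le hcost

theorem natLog_two_add_three_le (hn : 3 ≤ n) : (Nat.log 2 (n + 3) : ℝ) ≤ 4 * Real.log n := by
  have hpow : 2 ^ Nat.log 2 (n + 3) ≤ n ^ 2 :=
    (Nat.pow_log_le_self 2 (by lia)).trans (by nlinarith)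
  have hlog : Nat.log 2 (n + 3) * Real.log 2 ≤ 2 * Real.log n := by
    have h := Real.log_le_log (by positivity)
      (show (2 : ℝ) ^ Nat.log 2 (n + 3) ≤ (n : ℝ) ^ 2 by exact_mod_cast hpow)
    simpa only [Real.log_pow, Nat.cast_ofNat] using h
  have htwo : 1 / 2 ≤ Real.log 2 := by linarith [Real.log_two_gt_d9]
  have := mul_le_mul_of_nonneg_left htwo (Nat.cast_nonneg (α := ℝ) (Nat.log 2 (n + 3)))
  linarith

theorem tendsto_div_log_atTop :
    Filter.Tendsto (fun n : ℕ => n / Real.log n) Filter.atTop Filter.atTop := by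
  have hlim := Real.isLittleO_log_id_atTop.tendsto_div_nhds_zero.comp
    (tendsto_natCast_atTop_atTop (R := ℝ))
  have hpos : ∀ᶠ n : ℕ in Filter.atTop, 0 < Real.log n / n := by
    filter_upwards [Filter.eventually_gt_atTop 1] with n hn
    exact div_pos (Real.log_pos (by exact_mod_cast hn)) (by positivity)
  have hinv := (tendsto_nhdsWithin_iff.2 ⟨hlim, hpos⟩).inv_tendsto_nhdsGT_zero
  exact hinv.congr fun n => inv_div (Real.log n) (n : ℝ)

theorem stripPack_ratio_lower_bound : ∃ c : ℝ, 0 < c ∧ ∀ 𝒜 : OnlineAlgorithm,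
    stripPack.Solves 𝒜 → ∀ f : ℕ → ℝ, stripPack.HasAsymptoticCompetitiveRatio 𝒜 f →
      ∀ᶠ n : ℕ in Filter.atTop, c * (n / Real.log n) ≤ f n := by
  refine ⟨1 / 16, by norm_num, fun 𝒜 h𝒜 f ⟨β, hβ, hf⟩ => ?_⟩
  filter_upwards [tendsto_div_log_atTop.eventually_ge_atTop (8 * (β + 1)),
    Filter.eventually_ge_atTop 3] with n hn hn3
  obtain ⟨σ, rfl, hopt, hcost⟩ := exists_hard_sequence h𝒜 n
  have hlog : 0 < Real.log σ.length := Real.log_pos (by exact_mod_cast one_lt_two.trans_le (by lia))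
  have hcost₀ : 0 ≤ stripPack.algCost 𝒜 σ :=
    stripPack_cost_nonneg (Set.iUnion_subset (h𝒜 _).1)
  have hratio : σ.length / Real.log σ.length ≤ 4 * (stripPack.algCost 𝒜 σ + 1) := by
    rw [div_le_iff₀ hlog]
    have := mul_le_mul_of_nonneg_left (natLog_two_add_three_le hn3) (add_nonneg hcost₀ zero_le_one)
    linarith
  have hprod : σ.length / Real.log σ.length / 8 ≤ f σ.length * stripPack.opt σ := by
    linarith [hf σ]
  have hpos : 0 < f σ.length :=
    pos_of_mul_pos_left (by linarith) (opt_stripPack_nonneg σ)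
  have := mul_le_mul_of_nonneg_left hopt hpos.le
  linarith

end StripPacking

end LPacking

theorem corollary1p4 :
    -- (i) strip packing
    (∃ c : ℝ, 0 < c ∧ ∀ 𝒜 : LPacking.OnlineAlgorithm, LPacking.stripPack.Solves 𝒜 →
      ∀ f : ℕ → ℝ, LPacking.stripPack.HasAsymptoticCompetitiveRatio 𝒜 f →
        ∀ᶠ n : ℕ in Filter.atTop, c * (n / Real.log n) ≤ f n) ∧
    -- (ii) perimeter packing
    (∃ (C : ℝ) (𝒜 : LPacking.OnlineAlgorithm), LPacking.periPack.Solves 𝒜 ∧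
      LPacking.periPack.HasCompetitiveRatio 𝒜 (fun _ => C)) ∧
    -- (iii) area packing
    (∃ (C : ℝ) (𝒜 : LPacking.OnlineAlgorithm), LPacking.areaPack.Solves 𝒜 ∧
      LPacking.areaPack.HasAsymptoticCompetitiveRatio 𝒜 (fun n => C * √n)) ∧
    -- (iv) critical packing density
    ((∀ t : ℝ, t < 1 → 0 < LPacking.onlineCriticalDensity t) ∧
      LPacking.onlineCriticalDensity 1 = 0) :=
  ⟨LPacking.stripPack_ratio_lower_bound, LPacking.exists_periPack_hasCompetitiveRatio_const,
    LPacking.exists_areaPack_hasAsymptoticCompetitiveRatio_sqrt,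
    fun _ => LPacking.onlineCriticalDensity_pos, LPacking.onlineCriticalDensity_one⟩
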